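/- Let $d\in\mathbb N$ and let $m_1<\dots<m_d$ be integers; identify $\mathcal S_0=\{m_1,\dots,m_d\}$ with $\mathcal S_0\times\{0\}\subset\mathbb Z^2$. Put $$\mathscr S=\{(m_i,n):1\le i\le d,\ n\ne 0\},\qquad \mathscr C_{i,k}^{\pm}=\{(m,n)\in\mathbb Z^2:(m-m_i)(m-m_k)+n^2=0,\ \pm n>0\}\quad(i<k),$$ $\mathscr C_{i,k}=\mathscr C_{i,k}^+\cup\mathscr C_{i,k}^-$ and $\mathscr C=\bigcup_{i<k}\mathscr C_{i,k}$. Assume that $\mathcal S_0$ is generic: $\mathscr S\cap\mathscr C=\emptyset$, and $\mathscr C_{i,k}\cap\mathscr C_{i',k'}=\emptyset$ whenever $(i,k)\neq(i',k')$. **Admissibility.** Fix $p>1$. On the phase space of $(\mathcal Y,\theta,a)$, where $\mathcal Y\in\mathbb R^d$, $\theta\in\mathbb T^d$, $a=(a_{\vec\jmath})_{\vec\jmath\in\mathbb Z^2\setminus\mathcal S_0}$ and $\sum(1+|\vec\jmath|^2)^p|a_{\vec\jmath}|^2<\infty$, with symplectic form $\sum_i d\mathcal Y_i\wedge d\theta_i+\mathrm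 i\sum_{\vec\jmath}da_{\vec\jmath}\wedge d\bar a_{\vec\jmath}$, let $$\widetilde{\mathcal M}=\sum_i\mathcal Y_i+\sum_{\vec\jmath\notin\mathscr S\cup\mathscr C\cup\mathcal S_0}|a_{\vec\jmath}|^2,\qquad \widetilde{\mathcal P}_y=\sum_{(m,n)\notin\mathcal S_0} n|a_{(m,n)}|^2,$$ $$\widetilde{\mathcal P}_x=\sum_i m_i\mathcal Y_i+\sum_{(m,n)\notin\mathscr S\cup\mathscr C\cup\mathcal S_0}m|a_{(m,n)}|^2+\sum_{i<k}\ \sum_{(m,n)\in\mathscr C^+_{i,k}}(m-m_i)\big(|a_{(m,n)}|^2-|a_{(m_i+m_k-m,-n)}|^2\big).$$ For $\vec\jmath_1,\vec\jmath_2\in\mathbb Z^2\setminus\mathcal S_0$, $\ell\in\mathbb Z^d$ and $\sigma=(\sigma_1,\sigma_2)\in\{-1,0,1\}^2$, the triple $((\vec\jmath_1,\vec\jmath_2),\ell,\sigma)$ is called admissible if the monomial $e^{\mathrm i\theta\cdot\ell}a_{\vec\jmath_1}^{\sigma_1}a_{\vec\jmath_2}^{\sigma_2}$ Poisson commutes with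 $\widetilde{\mathcal M}$, $\widetilde{\mathcal P}_x$ and $\widetilde{\mathcal P}_y$; here $a^{+1}=a$, $a^{-1}=\bar a$, $a^0=1$. **Frequencies.** Let $\mathcal O_1\subseteq(0,\infty)^d$ be a set with nonempty interior. For $\lambda\in\mathcal O_1$ let $\mu_1(\lambda),\dots,\mu_d(\lambda)\in\mathbb R$ be the roots in $t$, with multiplicity, of $$P(t,\lambda)=\prod_{i=1}^d(t+\lambda_i)-2\sum_{i=1}^d\lambda_i\prod_{k\ne i}(t+\lambda_k),$$ and for $i<k$ let $\mu^+_{i,k}(\lambda),\mu^-_{i,k}(\lambda)\in\mathbb C$ be the two roots, with multiplicity, of $Q(t,\lambda_i,\lambda_k)=t^2-(\lambda_i-\lambda_k)t+3\lambda_i\lambda_k$, with any labelling for which all these functions are continuous on $\mathcal O_1$. For $\varepsilon>0$ put $\omega(\lambda)=(m_i^2-\varepsilon\lambda_i)_{1\le i\le d}$ and, for $\vec\jmath=(m,n)\in\mathbb Z^2\setminus\mathcal S_0$, $$\widetilde\Omega_{\vec\jmath}(\lambda,\varepsilon)=\begin{cases}m^2+n^2,&\vec\jmath\notin\mathscr S\cup\mathscr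 C,\\ \varepsilon\mu_i(\lambda)+n^2,&\vec\jmath=(m_i,n),\ n\neq0,\\ m^2+n^2-m_i^2+\varepsilon\mu^+_{i,k}(\lambda),&\vec\jmath\in\mathscr C^+_{i,k},\\ m^2+n^2-m_k^2-\varepsilon\mu^-_{i,k}(\lambda),&\vec\jmath\in\mathscr C^-_{i,k}.\end{cases}$$ **Claim.** Let $\varepsilon>0$ and let $((\vec\jmath_1,\vec\jmath_2),\ell,(\sigma_1,\sigma_2))$ be an admissible triple which is not of the form $((\vec\jmath,\vec\jmath),0,(\sigma_1,-\sigma_1))$ and for which $\ell$, $\sigma_1$, $\sigma_2$ are not all zero. Then the function $$\lambda\mapsto\omega(\lambda)\cdot\ell+\sigma_1\widetilde\Omega_{\vec\jmath_1}(\lambda,\varepsilon)+\sigma_2\widetilde\Omega_{\vec\jmath_2}(\lambda,\varepsilon)$$ does not vanish identically on $\mathcal O_1$. -/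

import Mathlib

noncomputable section

namespace NLSTorus

open Complex

/-! ### The tangential sites and the sets built from them -/

/-- The tangential sites `(m_i, 0)`, as points of `ℤ²`. -/
def tangentialSites {d : ℕ} (m : Fin d → ℤ) : Set (ℤ × ℤ) := {j | ∃ i, j = (m i, 0)}

/-- The row `{(m_i, n) : i}` at height `n`. -/
def row {d : ℕ} (m : Fin d → ℤ) (n : ℤ) : Set (ℤ × ℤ) := {j | ∃ i, j = (m i, n)}

/-- The union of all the rows at nonzero height. -/
def rows {d : ℕ} (m : Fin d → ℤ) : Set (ℤ × ℤ) := {j | ∃ n : ℤ, n ≠ 0 ∧ j ∈ row m n}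

/-- The integer points with `n > 0` on the circle of diameter `(m_i, 0)`, `(m_k, 0)`. -/
def circlePlus {d : ℕ} (m : Fin d → ℤ) (i k : Fin d) : Set (ℤ × ℤ) :=
  {j | (j.1 - m i) * (j.1 - m k) + j.2 ^ 2 = 0 ∧ 0 < j.2}

/-- The integer points with `n < 0` on the circle of diameter `(m_i, 0)`, `(m_k, 0)`. -/
def circleMinus {d : ℕ} (m : Fin d → ℤ) (i k : Fin d) : Set (ℤ × ℤ) :=
  {j | (j.1 - m i) * (j.1 - m k) + j.2 ^ 2 = 0 ∧ j.2 < 0}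

/-- The integer points with `n ≠ 0` on the circle of diameter `(m_i, 0)`, `(m_k, 0)`. -/
def circle {d : ℕ} (m : Fin d → ℤ) (i k : Fin d) : Set (ℤ × ℤ) :=
  circlePlus m i k ∪ circleMinus m i k

/-- The union of all the circles. -/
def circles {d : ℕ} (m : Fin d → ℤ) : Set (ℤ × ℤ) := {j | ∃ i k, i < k ∧ j ∈ circle m i k}

/-- Arithmetic genericity of the (strictly increasing) tuple of sites. -/
def IsGeneric {d : ℕ} (m : Fin d → ℤ) : Prop :=
  rows m ∩ circles m = ∅ ∧
  ∀ i k i' k' : Fin d, i < k → i' < k' → (i, k) ≠ (i', k') → circle m i k ∩ circle m i' k' = ∅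

/-! ### Phase space and Poisson bracket -/

/-- The normal sites: points of `ℤ²` that are not tangential. -/
abbrev NormalSite {d : ℕ} (m : Fin d → ℤ) : Type := {j : ℤ × ℤ // j ∉ tangentialSites m}

/-- Coordinates `(Y, θ, a)`: actions, angles (lifted to `ℝ^d`) and normal modes. -/
structure Coord {d : ℕ} (m : Fin d → ℤ) where
  Y : Fin d → ℝ
  θ : Fin d → ℝ
  a : NormalSite m → ℂ

/-- The normal modes lie in the weighted space `h^p`. -/
def InPhaseSpace {d : ℕ} {m : Fin d → ℤ} (p : ℝ) (x : Coord m) : Prop :=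
  Summable fun j : NormalSite m =>
    (1 + (j.1.1 : ℝ) ^ 2 + (j.1.2 : ℝ) ^ 2) ^ p * ‖x.a j‖ ^ 2

section Poisson

variable {d : ℕ} {m : Fin d → ℤ}

/-- `∂F/∂Y_i`. -/
def partialY (F : Coord m → ℂ) (i : Fin d) (x : Coord m) : ℂ :=
  deriv (fun t : ℝ => F { x with Y := Function.update x.Y i t }) (x.Y i)

/-- `∂F/∂θ_i`. -/
def partialTheta (F : Coord m → ℂ) (i : Fin d) (x : Coord m) : ℂ :=
  deriv (fun t : ℝ => F { x with θ := Function.update x.θ i t }) (x.θ i)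

/-- The derivative of `F` when the mode `a_j` moves in the direction `v`. -/
def partialDir (v : ℂ) (F : Coord m → ℂ) (j : NormalSite m) (x : Coord m) : ℂ :=
  deriv (fun t : ℝ => F { x with a := Function.update x.a j (x.a j + (t : ℂ) * v) }) 0

/-- The Wirtinger derivative `∂F/∂a_j`. -/
def partialA (F : Coord m → ℂ) (j : NormalSite m) (x : Coord m) : ℂ :=
  (partialDir 1 F j x - I * partialDir I F j x) / 2

/-- The Wirtinger derivative `∂F/∂(conj a_j)`. -/
def partialABar (F : Coord m → ℂ) (j : NormalSite m) (x : Coord m) : ℂ :=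
  (partialDir 1 F j x + I * partialDir I F j x) / 2

/-- The Poisson bracket of the symplectic form `∑ dY_i ∧ dθ_i + i ∑ da_j ∧ d(conj a_j)`, with
the sign for which `{Y_i, e^{iθ·ℓ}} = i ℓ_i e^{iθ·ℓ}` and `{|a_j|², a_j} = i a_j`. -/
def poisson (F G : Coord m → ℂ) (x : Coord m) : ℂ :=
  ∑ i, (partialY F i x * partialTheta G i x - partialTheta F i x * partialY G i x)
    + I * ∑' j : NormalSite m,
        (partialABar F j x * partialA G j x - partialA F j x * partialABar G j x)

open Classical in
/-- `|a_j|²` for a point `j` of `ℤ²`; there is no mode `a_j` at a tangential site, where the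
value is `0`. -/
def modeSq (x : Coord m) (j : ℤ × ℤ) : ℝ :=
  if h : j ∉ tangentialSites m then ‖x.a ⟨j, h⟩‖ ^ 2 else 0

/-- The mass in the final coordinates. -/
def massT (x : Coord m) : ℝ :=
  ∑ i, x.Y i
    + ∑' j : ((rows m ∪ circles m ∪ tangentialSites m)ᶜ : Set (ℤ × ℤ)), modeSq x j.1

open Classical in
/-- The first component of the momentum in the final coordinates. -/
def momentumXT (x : Coord m) : ℝ :=
  ∑ i, (m i : ℝ) * x.Y i
    + ∑' j : ((rows m ∪ circles m ∪ tangentialSites m)ᶜ : Set (ℤ × ℤ)),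
        (j.1.1 : ℝ) * modeSq x j.1
    + ∑ i, ∑ k, if i < k then
        ∑' j : circlePlus m i k, ((j.1.1 : ℝ) - (m i : ℝ)) *
          (modeSq x j.1 - modeSq x (m i + m k - j.1.1, -j.1.2))
      else 0

/-- The second component of the momentum in the final coordinates. -/
def momentumYT (x : Coord m) : ℝ := ∑' j : ℤ × ℤ, (j.2 : ℝ) * modeSq x j

/-- `z^σ` with the conventions `z^+ = z`, `z^- = conj z`, `z^0 = 1`. -/
def signPow (z : ℂ) : SignType → ℂ
  | SignType.pos => z
  | SignType.neg => (starRingEnd ℂ) z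
  | SignType.zero => 1

/-- The monomial `e^{iθ·ℓ} a_{j_1}^{σ_1} ⋯ a_{j_b}^{σ_b}`. -/
def monomial {b : ℕ} (j : Fin b → NormalSite m) (ℓ : Fin d → ℤ) (σ : Fin b → SignType)
    (x : Coord m) : ℂ :=
  exp (I * ∑ i, (ℓ i : ℂ) * (x.θ i : ℂ)) * ∏ r, signPow (x.a (j r)) (σ r)

/-- `(j, ℓ, σ)` is admissible: its monomial Poisson commutes with the mass and with both
components of the momentum, on the phase space of exponent `p`. -/
def Admissible (p : ℝ) {b : ℕ} (j : Fin b → NormalSite m) (ℓ : Fin d → ℤ)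
    (σ : Fin b → SignType) : Prop :=
  ∀ x : Coord m, InPhaseSpace p x →
    poisson (fun y => (massT y : ℂ)) (monomial j ℓ σ) x = 0 ∧
    poisson (fun y => (momentumXT y : ℂ)) (monomial j ℓ σ) x = 0 ∧
    poisson (fun y => (momentumYT y : ℂ)) (monomial j ℓ σ) x = 0

end Poisson

/-! ### Frequencies -/

/-- `P(t, λ) = ∏_i (t + λ_i) - 2 ∑_i λ_i ∏_{k ≠ i} (t + λ_k)`. -/
def polyP {d : ℕ} (t : ℝ) (lam : Fin d → ℝ) : ℝ :=
  ∏ i, (t + lam i) - 2 * ∑ i, lam i * ∏ k ∈ Finset.univ.erase i, (t + lam k)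

/-- `Q(t, λ_i, λ_k) = t² - (λ_i - λ_k) t + 3 λ_i λ_k`. -/
def polyQ (t : ℂ) (x y : ℝ) : ℂ := t ^ 2 - ((x : ℂ) - (y : ℂ)) * t + 3 * (x : ℂ) * (y : ℂ)

/-- On `O`, the `μ_i` are the roots (with multiplicity) of `P(·, λ)` and, for `i < k`,
the `μ_{ik}^+`, `μ_{ik}^-` are the roots of `Q(·, λ_i, λ_k)`, labelled so that each of them is a
continuous function of `λ ∈ O`. The discriminant of `Q` may be negative, so the latter are
complex valued. -/
structure IsRootLabelling {d : ℕ} (O : Set (Fin d → ℝ)) (μ : Fin d → (Fin d → ℝ) → ℝ)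
    (μp μm : Fin d → Fin d → (Fin d → ℝ) → ℂ) : Prop where
  cont : ∀ i, ContinuousOn (μ i) O
  roots : ∀ lam ∈ O, ∀ t : ℝ, polyP t lam = ∏ i, (t - μ i lam)
  cont_plus : ∀ i k, i < k → ContinuousOn (μp i k) O
  cont_minus : ∀ i k, i < k → ContinuousOn (μm i k) O
  roots_pair : ∀ i k, i < k → ∀ lam ∈ O, ∀ t : ℂ,
    polyQ t (lam i) (lam k) = (t - μp i k lam) * (t - μm i k lam)

/-- The tangential frequencies `ω(λ)_i = m_i² - ε λ_i`. -/
def tangentialFreq {d : ℕ} (m : Fin d → ℤ) (ε : ℝ) (lam : Fin d → ℝ) (i : Fin d) : ℝ :=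
  (m i : ℝ) ^ 2 - ε * lam i

open Classical in
/-- The normal frequencies. For strictly increasing generic `m`, the index `i` in the first
case and the pair `i < k` in the second case are unique and the cases are exclusive. -/
def normalFreq {d : ℕ} (m : Fin d → ℤ) (μ : Fin d → (Fin d → ℝ) → ℝ)
    (μp μm : Fin d → Fin d → (Fin d → ℝ) → ℂ) (ε : ℝ) (lam : Fin d → ℝ) (j : ℤ × ℤ) : ℂ :=
  if h : j.2 ≠ 0 ∧ ∃ i, j = (m i, j.2) then
    (ε : ℂ) * (μ h.2.choose lam : ℂ) + (j.2 : ℂ) ^ 2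
  else if h : ∃ q : Fin d × Fin d, q.1 < q.2 ∧ j ∈ circle m q.1 q.2 then
    if 0 < j.2 then
      (j.1 : ℂ) ^ 2 + (j.2 : ℂ) ^ 2 - (m h.choose.1 : ℂ) ^ 2
        + (ε : ℂ) * μp h.choose.1 h.choose.2 lam
    else
      (j.1 : ℂ) ^ 2 + (j.2 : ℂ) ^ 2 - (m h.choose.2 : ℂ) ^ 2
        - (ε : ℂ) * μm h.choose.1 h.choose.2 lam
  else (j.1 : ℂ) ^ 2 + (j.2 : ℂ) ^ 2

end NLSTorus

end

noncomputable section

namespace NLSTorus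

/-! Suppose the combination vanishes on all of `O`. Evaluating the three Poisson brackets at one
well-chosen point turns admissibility into linear selection rules on `ℓ` and `σ`
(`Admissible.selection`). The vanishing itself, divided by `ε`, says that a signed sum of roots of P
or Q is an affine function of λ on a set with nonempty interior. A resultant argument
(`IsRootRelation.exists_roots`) extends this: at every λ ∈ ℝ^d, positive or not, suitable roots
satisfy the same relation. All roots are 0 at λ = 0, so the constant term is zero
(`resonance_roots`). What remains is a linear relation that can be tested at convenient parameters.

For P the tests are the basis vectors, the vectors e_a + 6 e_b and the all-ones vector, where all
roots are explicit integers. They leave no linear form in λ to be matched, except for d = 1, where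
the root is λ itself and the selection rules conclude. For Q the test is λ_i = λ_k = 1, where the
roots are not real: a root of Q for one circle cannot be balanced by real quantities, hence neither
by a root of P nor by a root for another circle, whose roots become real when one of its parameters
is set to 0.

In every surviving case the exponents are opposite and the selection rules balance the first
coordinates. If the exponents are nonzero, the sites coincide; in either case the normal frequencies
cancel, `ℓ` is forced to be 0, and only the excluded triples remain. -/

/-! ### Relations between roots: from an open set to all parameters -/

open Polynomial in
/-- A relation between `λ ∈ ℝ^d` and `t ∈ ℂ` saying that `t` is a root of a monic polynomial
whose coefficients are polynomials in `λ`. -/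
def IsRootRelation {d : ℕ} (R : (Fin d → ℝ) → ℂ → Prop) : Prop :=
  ∃ F : (MvPolynomial (Fin d) ℂ)[X], F.Monic ∧
    ∀ lam t, R lam t ↔ (F.map (MvPolynomial.eval fun i => (lam i : ℂ))).eval t = 0

/-- An open set contains a box of real intervals, that is, a product of infinite subsets of ℂ. -/
lemma mvPolynomial_eq_zero_of_isOpen {d : ℕ} {U : Set (Fin d → ℝ)} (hU : IsOpen U)
    (hne : U.Nonempty) (p : MvPolynomial (Fin d) ℂ)
    (h : ∀ lam ∈ U, MvPolynomial.eval (fun i => (lam i : ℂ)) p = 0) : p = 0 := by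
  obtain ⟨x, hx⟩ := hne
  obtain ⟨r, hr, hrU⟩ := Metric.isOpen_iff.1 hU x hx
  refine MvPolynomial.funext_set (fun i => Complex.ofReal '' Metric.ball (x i) r)
    (fun i => ?_) fun z hz => ?_
  · refine Set.Infinite.image Complex.ofReal_injective.injOn ?_
    rw [Real.ball_eq_Ioo]
    exact Set.Ioo_infinite (by linarith)
  · choose y hy hyz using fun i => hz i (Set.mem_univ i)
    have hyU : y ∈ U := by
      apply hrU
      rw [Metric.mem_ball, dist_pi_lt_iff hr]
      exact hy
    obtain rfl : (fun i => (y i : ℂ)) = z := funext hyz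
    simpa using h y hyU

-- A common root exists exactly where the resultant vanishes, and the resultant is a polynomial in
-- λ. Monicity of `F` keeps its degree fixed under specialisation; the degree of `G` is allowed to
-- drop.
open Polynomial in
lemma exists_common_root_of_isOpen {d : ℕ} {U : Set (Fin d → ℝ)} (hU : IsOpen U)
    (hne : U.Nonempty) {F G : (MvPolynomial (Fin d) ℂ)[X]} (hF : F.Monic)
    (h : ∀ lam ∈ U, ∃ t, (F.map (MvPolynomial.eval fun i => (lam i : ℂ))).eval t = 0 ∧
      (G.map (MvPolynomial.eval fun i => (lam i : ℂ))).eval t = 0) (lam : Fin d → ℝ) :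
    ∃ t, (F.map (MvPolynomial.eval fun i => (lam i : ℂ))).eval t = 0 ∧
      (G.map (MvPolynomial.eval fun i => (lam i : ℂ))).eval t = 0 := by
  have key (lam : Fin d → ℝ) : MvPolynomial.eval (fun i => (lam i : ℂ)) (resultant F G) = 0 ↔
      ∃ t, (F.map (MvPolynomial.eval fun i => (lam i : ℂ))).eval t = 0 ∧
        (G.map (MvPolynomial.eval fun i => (lam i : ℂ))).eval t = 0 := by
    set φ := MvPolynomial.eval fun i => (lam i : ℂ)
    have hd : (F.map φ).natDegree = F.natDegree := hF.natDegree_map φ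
    rw [← resultant_map_map, ← hd, resultant_eq_prod_eval _ _ _ natDegree_map_le
      (IsAlgClosed.splits _), (hF.map φ).leadingCoeff, one_pow, one_mul, Multiset.prod_eq_zero_iff]
    simp only [Multiset.mem_map, mem_roots (hF.map φ).ne_zero, IsRoot.def]
  have h0 := mvPolynomial_eq_zero_of_isOpen hU hne (resultant F G) fun lam hl =>
    (key lam).2 (h lam hl)
  exact (key lam).1 (by rw [h0, map_zero])

open Polynomial in
/-- An affine relation between roots that holds on an open set of parameters holds for suitable
roots at every parameter. -/
lemma IsRootRelation.exists_roots {d : ℕ} {R S : (Fin d → ℝ) → ℂ → Prop}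
    (hR : IsRootRelation R) (hS : IsRootRelation S) {U : Set (Fin d → ℝ)} (hU : IsOpen U)
    (hne : U.Nonempty) (r : ℂ) {s : ℂ} (hs : s ≠ 0) (b : Fin d → ℂ) (c : ℂ)
    (h : ∀ lam ∈ U, ∃ t u, R lam t ∧ S lam u ∧ r * t + s * u = ∑ i, b i * lam i + c)
    (lam : Fin d → ℝ) :
    ∃ t u, R lam t ∧ S lam u ∧ r * t + s * u = ∑ i, b i * lam i + c := by
  obtain ⟨F, hF, hFR⟩ := hR
  obtain ⟨G, hG, hGS⟩ := hS
  let A : MvPolynomial (Fin d) ℂ := ∑ i, MvPolynomial.C (b i) * MvPolynomial.X i + MvPolynomial.C c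
  -- Solving the affine relation for `u` and substituting into `G` makes the relation a common root
  -- of `F` and `H`.
  let H := G.comp (C (MvPolynomial.C s⁻¹) * (C A - C (MvPolynomial.C r) * X))
  have hH (lam : Fin d → ℝ) (t : ℂ) :
      (H.map (MvPolynomial.eval fun i => (lam i : ℂ))).eval t = 0 ↔
        S lam (s⁻¹ * (∑ i, b i * lam i + c - r * t)) := by
    rw [hGS]
    simp [H, A, Polynomial.map_comp, Polynomial.map_sum, eval_finsetSum]
  obtain ⟨t, ht, ht'⟩ := exists_common_root_of_isOpen hU hne (G := H) hF (fun lam hl => by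
    obtain ⟨t, u, h1, h2, h3⟩ := h lam hl
    refine ⟨t, (hFR _ _).1 h1, (hH _ _).2 ?_⟩
    rw [← h3, add_sub_cancel_left, inv_mul_cancel_left₀ hs]
    exact h2) lam
  refine ⟨t, _, (hFR _ _).2 ht, (hH _ _).1 ht', ?_⟩
  rw [mul_inv_cancel_left₀ hs]
  ring

/-! ### The three root relations in use -/

/-- `t` vanishes. -/
def RootZero {d : ℕ} (_ : Fin d → ℝ) (t : ℂ) : Prop := t = 0

/-- `t` is a complex root of `P(·, λ)`. -/
def RootP {d : ℕ} (lam : Fin d → ℝ) (t : ℂ) : Prop :=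
  ∏ i, (t + lam i) - 2 * ∑ i, (lam i : ℂ) * ∏ k ∈ Finset.univ.erase i, (t + lam k) = 0

/-- `t` is a complex root of `Q(·, λ_i, λ_k)`. -/
def RootQ {d : ℕ} (i k : Fin d) (lam : Fin d → ℝ) (t : ℂ) : Prop := polyQ t (lam i) (lam k) = 0

open Polynomial in
lemma isRootRelation_rootZero {d : ℕ} : IsRootRelation (RootZero (d := d)) :=
  ⟨X, monic_X, fun lam t => by simp [RootZero]⟩

open Polynomial in
lemma isRootRelation_rootQ {d : ℕ} (i k : Fin d) : IsRootRelation (RootQ i k) := by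
  refine ⟨X ^ 2 + (C (MvPolynomial.X (R := ℂ) k - MvPolynomial.X i) * X +
    C (3 * MvPolynomial.X i * MvPolynomial.X k)), monic_X_pow_add degree_linear_lt,
    fun lam t => ?_⟩
  · simp only [RootQ, polyQ, C_sub]
    have h3 : MvPolynomial.eval (fun i => (lam i : ℂ)) 3 = 3 := map_ofNat _ 3
    simp only [Polynomial.map_add, Polynomial.map_sub, Polynomial.map_pow, map_X, Polynomial.map_mul,
      map_C, map_mul, MvPolynomial.eval_X, eval_add, eval_pow, eval_X,
      eval_mul, eval_C, h3, eval_sub]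
    ring_nf

open Polynomial in
lemma isRootRelation_rootP {d : ℕ} : IsRootRelation (RootP (d := d)) := by
  refine ⟨∏ i : Fin d, (X + C (MvPolynomial.X (R := ℂ) i)) - 2 * ∑ i : Fin d, C (MvPolynomial.X i) *
    ∏ k ∈ Finset.univ.erase i, (X + C (MvPolynomial.X k)), ?_, fun lam t => ?_⟩
  -- Each subtracted product omits one factor, so the leading term is that of the full product.
  · have hm (s : Finset (Fin d)) : (∏ k ∈ s, (X + C (MvPolynomial.X (R := ℂ) k))).Monic :=
      monic_prod_of_monic _ _ fun i _ => monic_X_add_C _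
    have hdeg (s : Finset (Fin d)) :
        (∏ k ∈ s, (X + C (MvPolynomial.X (R := ℂ) k))).degree = (s.card : WithBot ℕ) := by
      rw [degree_prod]
      simp [degree_X_add_C]
    refine (hm _).sub_of_left ?_
    rw [hdeg]
    rw [show (2 : (MvPolynomial (Fin d) ℂ)[X]) = C 2 from (map_ofNat C 2).symm,
      degree_C_mul two_ne_zero]
    refine (degree_sum_le _ _).trans_lt ?_
    rw [Finset.sup_lt_iff (WithBot.bot_lt_coe _)]
    intro i hi
    rw [degree_C_mul (MvPolynomial.X_ne_zero i), hdeg]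
    exact_mod_cast Finset.card_erase_lt_of_mem hi
  · simp [RootP, Polynomial.map_prod, Polynomial.map_sum, eval_prod, eval_finsetSum]

open Complex

/-! ### Brackets of quadratic Hamiltonians with monomials -/

section Bracket

variable {d : ℕ} {m : Fin d → ℤ}

/-- Only finitely many normal modes are excited. -/
def FinSupp (x : Coord m) : Prop := (Function.support x.a).Finite

/-- The quadratic Hamiltonian `∑ c_i Y_i + ∑ w_j |a_j|²`. -/
def quadHam (c : Fin d → ℝ) (w : ℤ × ℤ → ℝ) (x : Coord m) : ℝ :=
  ∑ i, c i * x.Y i + ∑' j, w j * modeSq x j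

lemma modeSq_coe (x : Coord m) (j : NormalSite m) : modeSq x j.1 = ‖x.a j‖ ^ 2 := by
  rw [modeSq, dif_pos j.2]

lemma FinSupp.modeSq {x : Coord m} (hx : FinSupp x) : (Function.support (modeSq x)).Finite := by
  refine (hx.image Subtype.val).subset fun j hj => ?_
  by_cases h : j ∉ tangentialSites m
  · refine ⟨⟨j, h⟩, fun h0 => hj ?_, rfl⟩
    simp [NLSTorus.modeSq, h, h0]
  · exact absurd (by simp [NLSTorus.modeSq, h]) hj

lemma FinSupp.summable {x : Coord m} (hx : FinSupp x) (w : ℤ × ℤ → ℝ) :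
    Summable fun j => w j * NLSTorus.modeSq x j :=
  summable_of_hasFiniteSupport (hx.modeSq.subset fun j hj h0 => hj (by simp [h0]))

lemma FinSupp.update {x : Coord m} (hx : FinSupp x) (j : NormalSite m) (z : ℂ) :
    FinSupp { x with a := Function.update x.a j z } := by
  refine (hx.union (Set.finite_singleton j)).subset fun k hk => ?_
  by_cases h : k = j
  · exact Or.inr h
  · left
    simpa [Function.update_of_ne h] using hk

/-- Finite support makes the series summable, so one mode can be changed separately. This is what
lets all partial derivatives be computed without convergence questions. -/
lemma quadHam_update {x : Coord m} (hx : FinSupp x) (c : Fin d → ℝ) (w : ℤ × ℤ → ℝ)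
    (j : NormalSite m) (z : ℂ) :
    quadHam c w { x with a := Function.update x.a j z } =
      quadHam c w x + w j.1 * (‖z‖ ^ 2 - ‖x.a j‖ ^ 2) := by
  have h (k : ℤ × ℤ) : w k * modeSq { x with a := Function.update x.a j z } k =
      w k * modeSq x k + if k = j.1 then w j.1 * (‖z‖ ^ 2 - ‖x.a j‖ ^ 2) else 0 := by
    split_ifs with hk
    · subst hk
      rw [modeSq_coe, modeSq_coe]
      simp only [Function.update_self]
      ring
    · by_cases hk' : k ∉ tangentialSites m
      · have hne : (⟨k, hk'⟩ : NormalSite m) ≠ j := fun e => hk (congrArg Subtype.val e)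
        simp [modeSq, hk', Function.update_of_ne hne]
      · simp [modeSq, hk']
  rw [quadHam, quadHam, tsum_congr h, Summable.tsum_add (hx.summable w), tsum_ite_eq]
  · ring
  · exact summable_of_hasFiniteSupport ((Set.finite_singleton j.1).subset fun k hk => by
      by_contra hne
      exact hk (if_neg hne))

lemma hasDerivAt_norm_sq_line (z v : ℂ) :
    HasDerivAt (fun t : ℝ => ‖z + (t : ℂ) * v‖ ^ 2) (2 * (z.re * v.re + z.im * v.im)) 0 := by
  have h (t : ℝ) : ‖z + (t : ℂ) * v‖ ^ 2 =
      (z.re + t * v.re) ^ 2 + (z.im + t * v.im) ^ 2 := by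
    rw [Complex.sq_norm, Complex.normSq_apply]
    simp
    ring
  simp_rw [h]
  have h1 := (((hasDerivAt_id (0 : ℝ)).mul_const v.re).const_add z.re).pow 2
  have h2 := (((hasDerivAt_id (0 : ℝ)).mul_const v.im).const_add z.im).pow 2
  refine (h1.add h2).congr_deriv ?_
  simp
  ring

lemma partialDir_quadHam {F : Coord m → ℝ} {c : Fin d → ℝ} {w : ℤ × ℤ → ℝ}
    (hF : ∀ y, FinSupp y → F y = quadHam c w y) {x : Coord m} (hx : FinSupp x) (v : ℂ)
    (j : NormalSite m) :
    partialDir v (fun y => (F y : ℂ)) j x =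
      ((w j.1 * (2 * ((x.a j).re * v.re + (x.a j).im * v.im)) : ℝ) : ℂ) := by
  refine HasDerivAt.deriv ?_
  apply HasDerivAt.ofReal_comp
  have h : (fun t : ℝ => F { x with a := Function.update x.a j (x.a j + (t : ℂ) * v) }) =
      fun t : ℝ => quadHam c w x + w j.1 * (‖x.a j + (t : ℂ) * v‖ ^ 2 - ‖x.a j‖ ^ 2) := by
    funext t
    rw [hF _ (hx.update j _), quadHam_update hx]
  rw [h]
  exact (((hasDerivAt_norm_sq_line (x.a j) v).sub_const _).const_mul _).const_add _

lemma partialA_quadHam {F : Coord m → ℝ} {c : Fin d → ℝ} {w : ℤ × ℤ → ℝ}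
    (hF : ∀ y, FinSupp y → F y = quadHam c w y) {x : Coord m} (hx : FinSupp x)
    (j : NormalSite m) :
    partialA (fun y => (F y : ℂ)) j x = w j.1 * (starRingEnd ℂ) (x.a j) := by
  rw [partialA, partialDir_quadHam hF hx, partialDir_quadHam hF hx]
  apply Complex.ext <;> simp <;> ring

lemma partialABar_quadHam {F : Coord m → ℝ} {c : Fin d → ℝ} {w : ℤ × ℤ → ℝ}
    (hF : ∀ y, FinSupp y → F y = quadHam c w y) {x : Coord m} (hx : FinSupp x)
    (j : NormalSite m) :
    partialABar (fun y => (F y : ℂ)) j x = w j.1 * x.a j := by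
  rw [partialABar, partialDir_quadHam hF hx, partialDir_quadHam hF hx]
  apply Complex.ext <;> simp <;> ring

lemma partialY_quadHam {F : Coord m → ℝ} {c : Fin d → ℝ} {w : ℤ × ℤ → ℝ}
    (hF : ∀ y, FinSupp y → F y = quadHam c w y) {x : Coord m} (hx : FinSupp x) (i : Fin d) :
    partialY (fun y => (F y : ℂ)) i x = c i := by
  refine HasDerivAt.deriv ?_
  apply HasDerivAt.ofReal_comp
  have h : (fun t : ℝ => F { x with Y := Function.update x.Y i t }) =
      fun t : ℝ => quadHam c w x + c i * (t - x.Y i) := by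
    funext t
    rw [hF _ (by exact hx), quadHam, quadHam]
    have h1 (k : Fin d) : c k * Function.update x.Y i t k =
        c k * x.Y k + if k = i then c i * (t - x.Y i) else 0 := by
      split_ifs with hk
      · subst hk
        rw [Function.update_self]
        ring
      · simp [Function.update_of_ne hk]
    simp only [h1, Finset.sum_add_distrib, Finset.sum_ite_eq', Finset.mem_univ, if_true]
    have h2 (k : ℤ × ℤ) : modeSq { x with Y := Function.update x.Y i t } k = modeSq x k := rfl
    simp only [h2]
    ring
  rw [h]
  simpa using (((hasDerivAt_id (x.Y i)).sub_const (x.Y i)).const_mul (c i)).const_add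
    (quadHam c w x)

lemma partialTheta_quadHam {F : Coord m → ℝ} {c : Fin d → ℝ} {w : ℤ × ℤ → ℝ}
    (hF : ∀ y, FinSupp y → F y = quadHam c w y) {x : Coord m} (hx : FinSupp x) (i : Fin d) :
    partialTheta (fun y => (F y : ℂ)) i x = 0 := by
  have h : (fun t : ℝ => (F { x with θ := Function.update x.θ i t } : ℂ)) = fun _ => (F x : ℂ) := by
    funext t
    rw [hF _ (by exact hx), hF _ hx]
    rfl
  rw [partialTheta, h, deriv_const]

open Classical in
/-- The point at which the given modes equal `1` and all other coordinates vanish. -/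
def testPoint {b : ℕ} (j : Fin b → NormalSite m) : Coord m where
  Y := 0
  θ := 0
  a := fun k => if k ∈ Set.range j then 1 else 0

lemma finSupp_testPoint {b : ℕ} (j : Fin b → NormalSite m) : FinSupp (testPoint j) := by
  refine (Set.finite_range j).subset fun k hk => ?_
  by_contra hne
  exact hk (if_neg hne)

lemma inPhaseSpace_testPoint {b : ℕ} (j : Fin b → NormalSite m) (p : ℝ) :
    InPhaseSpace p (testPoint j) :=
  summable_of_hasFiniteSupport ((finSupp_testPoint j).subset fun k hk h0 => hk (by simp [h0]))

lemma testPoint_apply {b : ℕ} (j : Fin b → NormalSite m) (r : Fin b) :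
    (testPoint j).a (j r) = 1 := if_pos ⟨r, rfl⟩

lemma signPow_one (s : SignType) : signPow 1 s = 1 := by cases s <;> simp [signPow]

lemma partialTheta_monomial {b : ℕ} (j : Fin b → NormalSite m) (ℓ : Fin d → ℤ)
    (σ : Fin b → SignType) (i : Fin d) :
    partialTheta (monomial j ℓ σ) i (testPoint j) = I * ℓ i := by
  refine HasDerivAt.deriv ?_
  have h : (fun t : ℝ => monomial j ℓ σ
      { testPoint j with θ := Function.update (testPoint j).θ i t }) =
      fun t : ℝ => exp (I * ((ℓ i : ℂ) * (t : ℂ))) := by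
    funext t
    have h1 (k : Fin d) : (ℓ k : ℂ) * (Function.update (testPoint j).θ i t k : ℝ) =
        if k = i then (ℓ i : ℂ) * (t : ℂ) else 0 := by
      split_ifs with hk
      · subst hk
        rw [Function.update_self]
      · rw [Function.update_of_ne hk]
        simp [testPoint]
    simp only [monomial, testPoint_apply, signPow_one, Finset.prod_const_one, mul_one, h1,
      Finset.sum_ite_eq', Finset.mem_univ, if_true]
  rw [h]
  have h2 : HasDerivAt (fun t : ℝ => I * ((ℓ i : ℂ) * (t : ℂ))) (I * ((ℓ i : ℂ) * 1))
      ((testPoint j).θ i) :=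
    ((Complex.ofRealCLM.hasDerivAt (x := (testPoint j).θ i)).const_mul _).const_mul _
  refine h2.cexp.congr_deriv ?_
  simp [testPoint]

lemma hasDerivAt_signPow (s : SignType) :
    HasDerivAt (fun t : ℝ => signPow (1 + (t : ℂ) * I) s) ((s : ℂ) * I) 0 := by
  have h : HasDerivAt (fun t : ℝ => 1 + (t : ℂ) * I) (1 * I) 0 :=
    ((Complex.ofRealCLM.hasDerivAt (x := (0 : ℝ))).mul_const I).const_add 1
  have h' : HasDerivAt (fun t : ℝ => 1 - (t : ℂ) * I) (-(1 * I)) 0 :=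
    ((Complex.ofRealCLM.hasDerivAt (x := (0 : ℝ))).mul_const I).const_sub 1
  cases s
  · simpa [signPow] using hasDerivAt_const (0 : ℝ) (1 : ℂ)
  · simpa [signPow, sub_eq_add_neg] using h'
  · simpa [signPow] using h

open Classical in
lemma partialDir_monomial {b : ℕ} (j : Fin b → NormalSite m) (ℓ : Fin d → ℤ)
    (σ : Fin b → SignType) (k : NormalSite m) (hk : k ∈ Set.range j) :
    partialDir I (monomial j ℓ σ) k (testPoint j) = I * ∑ r, if j r = k then (σ r : ℂ) else 0 := by
  refine HasDerivAt.deriv ?_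
  have hk1 : (testPoint j).a k = 1 := if_pos hk
  -- Several factors may sit at the same site `k`; the product over `r` with this case distinction
  -- accounts for all of them.
  let f : Fin b → ℝ → ℂ := fun r t => if j r = k then signPow (1 + (t : ℂ) * I) (σ r) else 1
  have h : (fun t : ℝ => monomial j ℓ σ { testPoint j with
      a := Function.update (testPoint j).a k ((testPoint j).a k + (t : ℂ) * I) }) =
      fun t : ℝ => ∏ r, f r t := by
    funext t
    have h0 : exp (I * ∑ i, (ℓ i : ℂ) * ((testPoint j).θ i : ℂ)) = 1 := by simp [testPoint]
    simp only [monomial, h0, one_mul]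
    refine Finset.prod_congr rfl fun r _ => ?_
    simp only [f]
    split_ifs with hr
    · rw [hr, Function.update_self, hk1]
    · rw [Function.update_of_ne hr, testPoint_apply, signPow_one]
  rw [h]
  have hf (r : Fin b) : HasDerivAt (f r) (if j r = k then (σ r : ℂ) * I else 0) 0 := by
    simp only [f]
    split_ifs
    · exact hasDerivAt_signPow _
    · exact hasDerivAt_const _ _
  have hf1 (r : Fin b) : f r 0 = 1 := by
    simp [f, signPow_one]
  refine (HasDerivAt.fun_finsetProd (u := Finset.univ) fun r _ => hf r).congr_deriv ?_
  simp only [hf1, Finset.prod_const_one, smul_eq_mul, one_mul, Finset.mul_sum]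
  refine Finset.sum_congr rfl fun r _ => ?_
  split_ifs <;> ring

/-- A monomial is an eigenvector of the bracket with a diagonal quadratic Hamiltonian; at
`testPoint` the monomial equals 1, so the bracket is the eigenvalue itself. -/
lemma poisson_quadHam {F : Coord m → ℝ} {c : Fin d → ℝ} {w : ℤ × ℤ → ℝ}
    (hF : ∀ y, FinSupp y → F y = quadHam c w y) {b : ℕ} (j : Fin b → NormalSite m)
    (ℓ : Fin d → ℤ) (σ : Fin b → SignType) :
    poisson (fun y => (F y : ℂ)) (monomial j ℓ σ) (testPoint j) =
      I * (∑ i, (c i : ℂ) * ℓ i + ∑ r, (w (j r).1 : ℂ) * (σ r : ℂ)) := by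
  classical
  have hx := finSupp_testPoint j
  rw [poisson]
  simp only [partialY_quadHam hF hx, partialTheta_quadHam hF hx, partialTheta_monomial,
    partialA_quadHam hF hx, partialABar_quadHam hF hx]
  have h (k : NormalSite m) :
      w k.1 * (testPoint j).a k * partialA (monomial j ℓ σ) k (testPoint j) -
        w k.1 * (starRingEnd ℂ) ((testPoint j).a k) *
          partialABar (monomial j ℓ σ) k (testPoint j) =
      ∑ r, if k = j r then (w (j r).1 : ℂ) * (σ r : ℂ) else 0 := by
    by_cases hk : k ∈ Set.range j
    · have hk1 : (testPoint j).a k = 1 := if_pos hk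
      have h2 : (∑ r, if k = j r then (w (j r).1 : ℂ) * (σ r : ℂ) else 0) =
          w k.1 * ∑ r, if j r = k then (σ r : ℂ) else 0 := by
        rw [Finset.mul_sum]
        refine Finset.sum_congr rfl fun r _ => ?_
        by_cases hr : j r = k
        · simp [hr]
        · simp [hr, Ne.symm hr]
      -- Since the mode equals 1, only the difference of the two Wirtinger derivatives enters, and
      -- this is `-I` times the derivative in the direction `I`.
      rw [h2, hk1, partialA, partialABar, partialDir_monomial j ℓ σ k hk, map_one]
      linear_combination (-(w k.1 : ℂ) * ∑ r, if j r = k then (σ r : ℂ) else 0) * I_sq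
    · have hk0 : (testPoint j).a k = 0 := if_neg hk
      rw [hk0, Finset.sum_eq_zero]
      · simp
      · intro r _
        rw [if_neg]
        rintro rfl
        exact hk ⟨r, rfl⟩
  have hs (r : Fin b) : Summable fun k : NormalSite m =>
      if k = j r then (w (j r).1 : ℂ) * (σ r : ℂ) else 0 :=
    summable_of_hasFiniteSupport ((Set.finite_singleton (j r)).subset fun k hk => by
      by_contra hne
      exact hk (if_neg hne))
  rw [tsum_congr h, Summable.tsum_finsetSum fun r _ => hs r]
  simp only [tsum_ite_eq, mul_add, Finset.mul_sum, zero_mul, sub_zero]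
  congr 1
  refine Finset.sum_congr rfl fun i _ => ?_
  ring

lemma linear_relation_of_poisson_eq_zero {F : Coord m → ℝ} {c : Fin d → ℝ} {w : ℤ × ℤ → ℝ}
    (hF : ∀ y, FinSupp y → F y = quadHam c w y) {b : ℕ} {j : Fin b → NormalSite m}
    {ℓ : Fin d → ℤ} {σ : Fin b → SignType}
    (h : poisson (fun y => (F y : ℂ)) (monomial j ℓ σ) (testPoint j) = 0) :
    ∑ i, c i * ℓ i + ∑ r, w (j r).1 * (σ r : ℝ) = 0 := by
  rw [poisson_quadHam hF] at h
  have h1 := (mul_eq_zero.1 h).resolve_left I_ne_zero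
  have hσ (s : SignType) : ((s : ℝ) : ℂ) = (s : ℂ) := by cases s <;> simp
  simp only [← hσ] at h1
  exact_mod_cast h1

end Bracket

/-! ### Selection rules and the weights of the conserved quantities -/

section Weights

variable {d : ℕ} {m : Fin d → ℤ}

open Classical in
/-- The coefficient of `|a_j|²` in the mass. -/
def massWeight (m : Fin d → ℤ) (j : ℤ × ℤ) : ℝ :=
  if j ∈ (rows m ∪ circles m ∪ tangentialSites m)ᶜ then 1 else 0

open Classical in
/-- The contribution of the circle of `(i, k)` to the coefficient of `|a_j|²` in the first
component of the momentum. -/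
def circleWeight (m : Fin d → ℤ) (i k : Fin d) (j : ℤ × ℤ) : ℝ :=
  (if j ∈ circlePlus m i k then (j.1 : ℝ) - m i else 0) -
    if j ∈ circleMinus m i k then (m k : ℝ) - j.1 else 0

open Classical in
/-- The coefficient of `|a_j|²` in the first component of the momentum. -/
def momentumXWeight (m : Fin d → ℤ) (j : ℤ × ℤ) : ℝ :=
  (if j ∈ (rows m ∪ circles m ∪ tangentialSites m)ᶜ then (j.1 : ℝ) else 0) +
    ∑ i, ∑ k, if i < k then circleWeight m i k j else 0

lemma massT_eq_quadHam (x : Coord m) : massT x = quadHam (fun _ => 1) (massWeight m) x := by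
  classical
  rw [massT, quadHam, tsum_subtype ((rows m ∪ circles m ∪ tangentialSites m)ᶜ) (modeSq x)]
  simp only [one_mul]
  congr 1
  refine tsum_congr fun j => ?_
  rw [massWeight, Set.indicator_apply]
  split_ifs <;> simp

lemma momentumYT_eq_quadHam (x : Coord m) :
    momentumYT x = quadHam (fun _ => 0) (fun j => (j.2 : ℝ)) x := by
  simp [momentumYT, quadHam]

/-- The point reflection exchanging the two halves of the circle of `(i, k)`. -/
def circleReflection (m : Fin d → ℤ) (i k : Fin d) : ℤ × ℤ ≃ ℤ × ℤ where
  toFun j := (m i + m k - j.1, -j.2)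
  invFun j := (m i + m k - j.1, -j.2)
  left_inv j := by ext <;> simp
  right_inv j := by ext <;> simp

lemma circleReflection_mem_circlePlus (i k : Fin d) (j : ℤ × ℤ) :
    circleReflection m i k j ∈ circlePlus m i k ↔ j ∈ circleMinus m i k := by
  simp only [circlePlus, circleMinus, circleReflection, Equiv.coe_fn_mk, Set.mem_ofPred_eq,
    neg_sq, Left.neg_pos_iff]
  rw [show (m i + m k - j.1 - m i) * (m i + m k - j.1 - m k) = (j.1 - m i) * (j.1 - m k) by ring]

/-- Reindexing the subtracted modes by the point reflection moves them to the lower half circle,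
where the factor `j.1 - m i` becomes `m k - j.1`. -/
lemma FinSupp.tsum_circlePlus {x : Coord m} (hx : FinSupp x) (i k : Fin d) :
    ∑' j : circlePlus m i k, ((j.1.1 : ℝ) - (m i : ℝ)) *
      (NLSTorus.modeSq x j.1 - NLSTorus.modeSq x (m i + m k - j.1.1, -j.1.2)) =
    ∑' j, circleWeight m i k j * NLSTorus.modeSq x j := by
  classical
  let f : ℤ × ℤ → ℝ := fun j => if j ∈ circlePlus m i k then (j.1 : ℝ) - m i else 0
  let g : ℤ × ℤ → ℝ := fun j => if j ∈ circleMinus m i k then (m k : ℝ) - j.1 else 0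
  have hfg (j : ℤ × ℤ) : f (circleReflection m i k j) = g j := by
    simp only [f, g, circleReflection_mem_circlePlus]
    split_ifs
    · simp only [circleReflection, Equiv.coe_fn_mk]
      push_cast
      ring
    · rfl
  have hgs : Summable fun j => f j * NLSTorus.modeSq x (circleReflection m i k j) := by
    rw [← (circleReflection m i k).summable_iff]
    refine (hx.summable g).congr fun j => ?_
    simp only [Function.comp_apply, hfg]
    simp [circleReflection]
  rw [tsum_subtype (circlePlus m i k) fun j => ((j.1 : ℝ) - (m i : ℝ)) *
    (NLSTorus.modeSq x j - NLSTorus.modeSq x (m i + m k - j.1, -j.2))]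
  have h1 (j : ℤ × ℤ) : (circlePlus m i k).indicator (fun j => ((j.1 : ℝ) - (m i : ℝ)) *
      (NLSTorus.modeSq x j - NLSTorus.modeSq x (m i + m k - j.1, -j.2))) j =
      f j * NLSTorus.modeSq x j - f j * NLSTorus.modeSq x (circleReflection m i k j) := by
    rw [Set.indicator_apply]
    simp only [f, circleReflection, Equiv.coe_fn_mk]
    split_ifs <;> ring
  have h2 : ∑' j, f j * NLSTorus.modeSq x (circleReflection m i k j) =
      ∑' j, g j * NLSTorus.modeSq x j := by
    rw [← (circleReflection m i k).tsum_eq]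
    refine tsum_congr fun j => ?_
    rw [hfg]
    simp [circleReflection]
  rw [tsum_congr h1, Summable.tsum_sub (hx.summable f) hgs, h2,
    ← Summable.tsum_sub (hx.summable f) (hx.summable g)]
  refine tsum_congr fun j => ?_
  rw [← sub_mul]
  rfl

lemma FinSupp.momentumXT_eq_quadHam {x : Coord m} (hx : FinSupp x) :
    momentumXT x = quadHam (fun i => (m i : ℝ)) (momentumXWeight m) x := by
  classical
  have h1 (i k : Fin d) : (if i < k then ∑' j : circlePlus m i k, ((j.1.1 : ℝ) - (m i : ℝ)) *
        (NLSTorus.modeSq x j.1 - NLSTorus.modeSq x (m i + m k - j.1.1, -j.1.2)) else 0) =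
      ∑' j, (if i < k then circleWeight m i k j else 0) * NLSTorus.modeSq x j := by
    split_ifs
    · exact hx.tsum_circlePlus i k
    · simp
  rw [momentumXT, quadHam, tsum_subtype ((rows m ∪ circles m ∪ tangentialSites m)ᶜ)
    fun j => (j.1 : ℝ) * NLSTorus.modeSq x j, add_assoc]
  congr 1
  simp only [h1]
  have h2 (j : ℤ × ℤ) : ((rows m ∪ circles m ∪ tangentialSites m)ᶜ).indicator
      (fun j => (j.1 : ℝ) * NLSTorus.modeSq x j) j =
      (if j ∈ (rows m ∪ circles m ∪ tangentialSites m)ᶜ then (j.1 : ℝ) else 0) *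
        NLSTorus.modeSq x j := by
    rw [Set.indicator_apply]
    split_ifs <;> simp
  rw [tsum_congr h2]
  have h3 (i : Fin d) :
      ∑ k, ∑' j, (if i < k then circleWeight m i k j else 0) * NLSTorus.modeSq x j =
      ∑' j, (∑ k, if i < k then circleWeight m i k j else 0) * NLSTorus.modeSq x j := by
    rw [← Summable.tsum_finsetSum fun k _ => hx.summable _]
    simp only [Finset.sum_mul]
  simp only [h3]
  rw [← Summable.tsum_finsetSum fun k _ => hx.summable _]
  simp only [← Finset.sum_mul]
  rw [← Summable.tsum_add (hx.summable _) (hx.summable _)]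
  simp only [← add_mul]
  rfl

/-- Admissibility amounts to three linear selection rules. -/
lemma Admissible.selection {p : ℝ} {b : ℕ} {j : Fin b → NormalSite m} {ℓ : Fin d → ℤ}
    {σ : Fin b → SignType} (h : Admissible p j ℓ σ) :
    ∑ i, (ℓ i : ℝ) + ∑ r, massWeight m (j r).1 * (σ r : ℝ) = 0 ∧
    ∑ i, (m i : ℝ) * ℓ i + ∑ r, momentumXWeight m (j r).1 * (σ r : ℝ) = 0 ∧
    ∑ r, ((j r).1.2 : ℝ) * (σ r : ℝ) = 0 := by
  obtain ⟨h1, h2, h3⟩ := h (testPoint j) (inPhaseSpace_testPoint j p)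
  refine ⟨?_, ?_, ?_⟩
  · simpa using linear_relation_of_poisson_eq_zero (fun y _ => massT_eq_quadHam y) h1
  · exact linear_relation_of_poisson_eq_zero (fun y hy => hy.momentumXT_eq_quadHam) h2
  · simpa using linear_relation_of_poisson_eq_zero (fun y _ => momentumYT_eq_quadHam y) h3

lemma mem_circles {i k : Fin d} (hik : i < k) {j : ℤ × ℤ} (hj : j ∈ circle m i k) :
    j ∈ circles m := ⟨i, k, hik, hj⟩

lemma circleWeight_of_notMem {i k : Fin d} {j : ℤ × ℤ} (hj : j ∉ circle m i k) :
    circleWeight m i k j = 0 := by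
  simp only [circle, Set.mem_union, not_or] at hj
  simp [circleWeight, hj.1, hj.2]

lemma momentumXWeight_of_notMem_circles {j : ℤ × ℤ} (hj : j ∉ circles m) :
    (∑ i, ∑ k, if i < k then circleWeight m i k j else 0) = 0 := by
  refine Finset.sum_eq_zero fun i _ => Finset.sum_eq_zero fun k _ => ?_
  split_ifs with hik
  · exact circleWeight_of_notMem fun h => hj (mem_circles hik h)
  · rfl

lemma massWeight_free {j : ℤ × ℤ} (h0 : j ∉ tangentialSites m) (h1 : j ∉ rows m)
    (h2 : j ∉ circles m) : massWeight m j = 1 := by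
  simp [massWeight, h0, h1, h2]

lemma momentumXWeight_free {j : ℤ × ℤ} (h0 : j ∉ tangentialSites m) (h1 : j ∉ rows m)
    (h2 : j ∉ circles m) : momentumXWeight m j = j.1 := by
  rw [momentumXWeight, momentumXWeight_of_notMem_circles h2]
  simp [h0, h1, h2]

lemma massWeight_rows {j : ℤ × ℤ} (h1 : j ∈ rows m) : massWeight m j = 0 := by
  simp [massWeight, h1]

lemma massWeight_circles {j : ℤ × ℤ} (h1 : j ∈ circles m) : massWeight m j = 0 := by
  simp [massWeight, h1]

lemma IsGeneric.notMem_circles (hm : IsGeneric m) {j : ℤ × ℤ} (h1 : j ∈ rows m) :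
    j ∉ circles m := fun h2 => by
  have : j ∈ rows m ∩ circles m := ⟨h1, h2⟩
  simp [hm.1] at this

lemma IsGeneric.circle_unique (hm : IsGeneric m) {j : ℤ × ℤ} {i k i' k' : Fin d} (hik : i < k)
    (hik' : i' < k') (hj : j ∈ circle m i k) (hj' : j ∈ circle m i' k') : (i, k) = (i', k') := by
  by_contra hne
  have : j ∈ circle m i k ∩ circle m i' k' := ⟨hj, hj'⟩
  simp [hm.2 i k i' k' hik hik' hne] at this

lemma momentumXWeight_rows (hm : IsGeneric m) {j : ℤ × ℤ} (h1 : j ∈ rows m) :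
    momentumXWeight m j = 0 := by
  rw [momentumXWeight, momentumXWeight_of_notMem_circles (hm.notMem_circles h1)]
  simp [h1]

/-- Circles of different pairs are disjoint, so a single term of the double sum survives. -/
lemma momentumXWeight_circle (hm : IsGeneric m) {j : ℤ × ℤ} {i k : Fin d} (hik : i < k)
    (hj : j ∈ circle m i k) : momentumXWeight m j = circleWeight m i k j := by
  have h (i' k' : Fin d) : (if i' < k' then circleWeight m i' k' j else 0) =
      if i' = i then (if k' = k then circleWeight m i k j else 0) else 0 := by
    split_ifs with h1 h2 h3 h4 h5
    · rw [h2, h3]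
    · exact circleWeight_of_notMem fun hc => h3 (Prod.ext_iff.1 (hm.circle_unique h1 hik hc hj)).2
    · exact circleWeight_of_notMem fun hc => h2 (Prod.ext_iff.1 (hm.circle_unique h1 hik hc hj)).1
    · subst h4 h5
      exact absurd hik h1
    · rfl
    · rfl
  simp only [momentumXWeight, h]
  simp [mem_circles hik hj]

lemma momentumXWeight_circlePlus (hm : IsGeneric m) {j : ℤ × ℤ} {i k : Fin d} (hik : i < k)
    (hj : j ∈ circlePlus m i k) : momentumXWeight m j = j.1 - m i := by
  rw [momentumXWeight_circle hm hik (Or.inl hj), circleWeight, if_pos hj, if_neg, sub_zero]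
  exact fun h => lt_asymm h.2 hj.2

lemma momentumXWeight_circleMinus (hm : IsGeneric m) {j : ℤ × ℤ} {i k : Fin d} (hik : i < k)
    (hj : j ∈ circleMinus m i k) : momentumXWeight m j = j.1 - m k := by
  rw [momentumXWeight_circle hm hik (Or.inr hj), circleWeight, if_pos hj, if_neg]
  · ring
  · exact fun h => lt_asymm h.2 hj.2

end Weights

/-! ### Roots of P and Q at special parameters; simplicity of the roots of P -/

section Roots

variable {d : ℕ}

/-- If `λ` vanishes outside `S`, then the nonzero roots of `P(·, λ)` are those of the polynomial
of the restriction of `λ` to `S`. -/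
lemma RootP.restrict {lam : Fin d → ℝ} {t : ℂ} (h : RootP lam t) (S : Finset (Fin d))
    (hS : ∀ i ∉ S, lam i = 0) : t = 0 ∨
    ∏ i ∈ S, (t + lam i) - 2 * ∑ i ∈ S, (lam i : ℂ) * ∏ k ∈ S.erase i, (t + lam k) = 0 := by
  have hc : ∏ i ∈ Sᶜ, (t + lam i) = t ^ (Sᶜ).card := by
    refine Finset.prod_eq_pow_card fun i hi => ?_
    rw [hS i (Finset.mem_compl.1 hi)]
    simp
  have h1 : ∏ i, (t + lam i) = (∏ i ∈ S, (t + lam i)) * t ^ (Sᶜ).card := by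
    rw [← hc, Finset.prod_mul_prod_compl]
  have h2 : ∑ i, (lam i : ℂ) * ∏ k ∈ Finset.univ.erase i, (t + lam k) =
      (∑ i ∈ S, (lam i : ℂ) * ∏ k ∈ S.erase i, (t + lam k)) * t ^ (Sᶜ).card := by
    rw [Finset.sum_mul, ← Finset.sum_subset (Finset.subset_univ S)]
    · refine Finset.sum_congr rfl fun i hi => ?_
      have hd : Disjoint (S.erase i) Sᶜ :=
        Finset.disjoint_of_subset_left (Finset.erase_subset _ _) disjoint_compl_right
      have he : Finset.univ.erase i = S.erase i ∪ Sᶜ := by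
        ext k
        simp only [Finset.mem_erase, Finset.mem_univ, and_true, Finset.mem_union,
          Finset.mem_compl]
        by_cases hk : k = i
        · simp [hk, hi]
        · simp [hk, em]
      rw [he, Finset.prod_union hd, hc, mul_assoc]
    · intro i _ hi
      simp [hS i hi]
  have h3 : (∏ i ∈ S, (t + lam i) - 2 * ∑ i ∈ S, (lam i : ℂ) * ∏ k ∈ S.erase i, (t + lam k)) *
      t ^ (Sᶜ).card = 0 := by
    rw [sub_mul, ← h1, mul_assoc, ← h2]
    exact h
  rcases mul_eq_zero.1 h3 with h4 | h4
  · exact Or.inr h4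
  · exact Or.inl (by by_contra ht; exact pow_ne_zero _ ht h4)

lemma RootP.single {a : Fin d} {t : ℂ} (h : RootP (Pi.single a 1) t) :
    ∃ r : ℝ, t = r ∧ (r = 0 ∨ r = 1) := by
  rcases h.restrict {a} (fun i hi => by
    rw [Pi.single_eq_of_ne (by simpa using hi)]) with h0 | h0
  · exact ⟨0, by simpa using h0, Or.inl rfl⟩
  · refine ⟨1, ?_, Or.inr rfl⟩
    simp at h0
    push_cast
    linear_combination h0

/-- For two parameters x, y the polynomial is t² - (x + y) t - 3xy. The choice (1, 6) makes its
discriminant 49 + 72 = 11², so the roots are integers; their values defeat the small coefficients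
allowed by `RootP.single`. -/
lemma RootP.pair {a b : Fin d} (hab : a ≠ b) {t : ℂ}
    (h : RootP (Pi.single a 1 + Pi.single b 6) t) :
    ∃ r : ℝ, t = r ∧ (r = 0 ∨ r = 9 ∨ r = -2) := by
  rcases h.restrict {a, b} (fun i hi => by
    simp only [Finset.mem_insert, Finset.mem_singleton, not_or] at hi
    simp [hi.1, hi.2]) with h0 | h0
  · exact ⟨0, by simpa using h0, Or.inl rfl⟩
  · have e1 : ({a, b} : Finset (Fin d)).erase a = {b} := by
      ext k
      simp only [Finset.mem_erase, Finset.mem_insert, Finset.mem_singleton]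
      grind
    have e2 : ({a, b} : Finset (Fin d)).erase b = {a} := by
      ext k
      simp only [Finset.mem_erase, Finset.mem_insert, Finset.mem_singleton]
      grind
    rw [Finset.prod_pair hab, Finset.sum_pair hab, e1, e2] at h0
    simp [hab, hab.symm] at h0
    have h1 : (t - 9) * (t + 2) = 0 := by linear_combination h0
    rcases mul_eq_zero.1 h1 with h2 | h2
    · exact ⟨9, by push_cast; linear_combination h2, by simp⟩
    · exact ⟨-2, by push_cast; linear_combination h2, by simp⟩

/-- For d ≥ 1 the polynomial is (t + 1)^(d - 1) (t + 1 - 2d); the root -1 needs d ≥ 2, and for d = 0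
there is no root. -/
lemma RootP.ones {t : ℂ} (h : RootP (fun _ : Fin d => 1) t) :
    ∃ r : ℝ, t = r ∧ 1 ≤ d ∧ ((r = -1 ∧ 2 ≤ d) ∨ r = 2 * d - 1) := by
  simp only [RootP, Finset.prod_const, Finset.card_erase_of_mem (Finset.mem_univ _),
    Finset.card_univ, Fintype.card_fin, Finset.sum_const, Complex.ofReal_one, one_mul,
    nsmul_eq_mul] at h
  rcases d with _ | d
  · simp at h
  · have h1 : (t + 1) ^ d * (t + 1 - 2 * (d + 1)) = 0 := by
      simp only [Nat.add_sub_cancel, Nat.cast_add, Nat.cast_one, pow_succ] at h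
      linear_combination h
    rcases mul_eq_zero.1 h1 with h2 | h2
    · have hd : d ≠ 0 := by
        rintro rfl
        simp at h2
      refine ⟨-1, ?_, by omega, Or.inl ⟨rfl, by omega⟩⟩
      have h3 : t + 1 = 0 := by
        by_contra ht
        exact pow_ne_zero _ ht h2
      push_cast
      linear_combination h3
    · refine ⟨2 * (d + 1 : ℕ) - 1, ?_, by omega, Or.inr rfl⟩
      push_cast
      linear_combination h2

lemma RootP.zero {t : ℂ} (h : RootP (0 : Fin d → ℝ) t) : t = 0 := by
  rcases h.restrict ∅ (fun i _ => rfl) with h0 | h0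
  · exact h0
  · simp at h0

lemma RootQ.zero {i k : Fin d} {t : ℂ} (h : RootQ i k 0 t) : t = 0 := by
  simpa [RootQ, polyQ] using h

/-- At equal parameters the roots of `Q` are not real. -/
lemma RootQ.not_real {i k : Fin d} {lam : Fin d → ℝ} (hi : lam i = 1) (hk : lam k = 1) {r : ℝ}
    (h : RootQ i k lam r) : False := by
  simp only [RootQ, polyQ, hi, hk] at h
  have h1 : r ^ 2 + 3 = 0 := by
    have : ((r ^ 2 + 3 : ℝ) : ℂ) = 0 := by
      push_cast at h ⊢
      linear_combination h
    exact_mod_cast this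
  nlinarith [sq_nonneg r]

/-- When one parameter vanishes, the roots of `Q` are real. -/
lemma RootQ.real {i k : Fin d} {lam : Fin d → ℝ} (h0 : lam i = 0 ∨ lam k = 0) {t : ℂ}
    (h : RootQ i k lam t) : ∃ r : ℝ, t = r := by
  have h1 : t * (t - ((lam i - lam k : ℝ) : ℂ)) = 0 := by
    simp only [RootQ, polyQ] at h
    have h2 : (lam i : ℂ) * lam k = 0 := by
      rcases h0 with h0 | h0 <;> simp [h0]
    push_cast
    linear_combination h - 3 * h2
  rcases mul_eq_zero.1 h1 with h2 | h2
  · exact ⟨0, by simpa using h2⟩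
  · exact ⟨_, sub_eq_zero.1 h2⟩

lemma sum_mul_single (b : Fin d → ℝ) (a : Fin d) :
    ∑ i, b i * (Pi.single a 1 : Fin d → ℝ) i = b a := by
  simp [Pi.single_apply]

lemma sum_mul_pair (b : Fin d → ℝ) (a a' : Fin d) :
    ∑ i, b i * (Pi.single a 1 + Pi.single a' 6 : Fin d → ℝ) i = b a + 6 * b a' := by
  simp [Pi.single_apply, mul_add, Finset.sum_add_distrib, mul_comm]

/-- A linear form is a root of `P` only for `d = 1`. -/
lemma eq_of_linear_root {e : ℝ} (he : e = 1 ∨ e = -1) {b : Fin d → ℝ}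
    (h : ∀ lam : Fin d → ℝ, ∃ t : ℂ, RootP lam t ∧ (e : ℂ) * t = ((∑ i, b i * lam i : ℝ) : ℂ)) :
    d = 1 ∧ ∑ i, b i = e := by
  have hsub : ∀ a a' : Fin d, a = a' := by
    by_contra hne
    push Not at hne
    obtain ⟨x, y, hxy⟩ := hne
    have hb : ∀ a, b a = 0 := by
      intro a
      obtain ⟨a', ha'⟩ : ∃ a', a ≠ a' := by
        by_cases hax : a = x
        · exact ⟨y, hax ▸ hxy⟩
        · exact ⟨x, hax⟩
      obtain ⟨t, ht, h1⟩ := h (Pi.single a 1)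
      obtain ⟨r, rfl, hr⟩ := ht.single
      obtain ⟨t', ht', h2⟩ := h (Pi.single a' 1)
      obtain ⟨r', rfl, hr'⟩ := ht'.single
      obtain ⟨u, hu, h3⟩ := h (Pi.single a 1 + Pi.single a' 6)
      obtain ⟨s, rfl, hs⟩ := hu.pair ha'
      rw [sum_mul_single] at h1 h2
      rw [sum_mul_pair] at h3
      norm_cast at h1 h2 h3
      -- Up to the sign `e`, both coefficients lie in {0, 1}, so `b a + 6 * b a'` lies in {0, 1, 6,
      -- 7}, which meets {0, 9, -2} only in 0.
      rcases he with rfl | rfl <;> rcases hr with rfl | rfl <;> rcases hr' with rfl | rfl <;>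
        rcases hs with rfl | rfl | rfl <;> linarith
    -- With all coefficients zero, 0 would be a root at the all-ones vector, but the roots there are
    -- -1 and 2d - 1.
    obtain ⟨t, ht, h1⟩ := h fun _ => 1
    obtain ⟨r, rfl, hd, hr⟩ := ht.ones
    simp only [hb, zero_mul, Finset.sum_const_zero] at h1
    norm_cast at h1
    have hd' : (1 : ℝ) ≤ d := by exact_mod_cast hd
    rcases he with rfl | rfl <;> rcases hr with ⟨rfl, -⟩ | rfl <;> linarith
  obtain ⟨t, ht, h1⟩ := h fun _ => 1
  obtain ⟨r, rfl, hd, hr⟩ := ht.ones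
  have hd1 : d = 1 := by
    by_contra hne
    exact absurd (hsub ⟨0, by omega⟩ ⟨1, by omega⟩) (by simp)
  refine ⟨hd1, ?_⟩
  norm_cast at h1
  rcases hr with ⟨-, h2⟩ | rfl
  · omega
  · subst hd1
    simp only [mul_one] at h1
    rw [← h1]
    norm_num

/-- Basis vectors give `e * b a` as a sum of two elements of {0, 1}; being nonnegative with sum
zero, all coefficients vanish. At the all-ones vector two roots would then add up to zero, but the
possible sums are -2, 2d - 2 with d ≥ 2, and 4d - 2. -/
lemma not_linear_add {e : ℝ} (he : e = 1 ∨ e = -1) {b : Fin d → ℝ} (hb : ∑ i, b i = 0)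
    (h : ∀ lam : Fin d → ℝ, ∃ t u : ℂ, RootP lam t ∧ RootP lam u ∧
      (e : ℂ) * t + (e : ℂ) * u = ((∑ i, b i * lam i : ℝ) : ℂ)) : False := by
  have h0 (a : Fin d) : 0 ≤ e * b a := by
    obtain ⟨t, u, ht, hu, h1⟩ := h (Pi.single a 1)
    obtain ⟨r, rfl, hr⟩ := ht.single
    obtain ⟨s, rfl, hs⟩ := hu.single
    rw [sum_mul_single] at h1
    norm_cast at h1
    rcases he with rfl | rfl <;> rcases hr with rfl | rfl <;> rcases hs with rfl | rfl <;> linarith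
  have h1 := (Finset.sum_eq_zero_iff_of_nonneg fun a _ => h0 a).1 (by
    rw [← Finset.mul_sum, hb, mul_zero])
  have hb0 (a : Fin d) : b a = 0 := by
    rcases mul_eq_zero.1 (h1 a (Finset.mem_univ a)) with h2 | h2
    · rcases he with rfl | rfl <;> norm_num at h2
    · exact h2
  obtain ⟨t, u, ht, hu, h2⟩ := h fun _ => 1
  obtain ⟨r, rfl, hd, hr⟩ := ht.ones
  obtain ⟨s, rfl, -, hs⟩ := hu.ones
  simp only [hb0, zero_mul, Finset.sum_const_zero] at h2
  norm_cast at h2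
  have h3 : r + s = 0 := by
    rcases he with rfl | rfl <;> linarith
  have hd1 : (1 : ℝ) ≤ d := by exact_mod_cast hd
  rcases hr with ⟨rfl, hd'⟩ | rfl
  · have hd2 : (2 : ℝ) ≤ d := by exact_mod_cast hd'
    rcases hs with ⟨rfl, -⟩ | rfl <;> linarith
  · rcases hs with ⟨rfl, hd'⟩ | rfl
    · have hd2 : (2 : ℝ) ≤ d := by exact_mod_cast hd'
      linarith
    · linarith

/-- Basis vectors give coefficients in {0, 1, -1}. If `b a = ±1`, then `b a + 6 * b a'` is ±1, ±5 or
±7, none of which is a difference of elements of {0, 9, -2}. With a single index the zero sum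
suffices. -/
lemma eq_zero_of_linear_sub {b : Fin d → ℝ} (hb : ∑ i, b i = 0)
    (h : ∀ lam : Fin d → ℝ, ∃ t u : ℂ, RootP lam t ∧ RootP lam u ∧
      t - u = ((∑ i, b i * lam i : ℝ) : ℂ)) (a : Fin d) : b a = 0 := by
  have h0 (a : Fin d) : b a = 0 ∨ b a = 1 ∨ b a = -1 := by
    obtain ⟨t, u, ht, hu, h1⟩ := h (Pi.single a 1)
    obtain ⟨r, rfl, hr⟩ := ht.single
    obtain ⟨s, rfl, hs⟩ := hu.single
    rw [sum_mul_single] at h1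
    norm_cast at h1
    rw [← h1]
    rcases hr with rfl | rfl <;> rcases hs with rfl | rfl <;> norm_num
  by_cases ha : ∃ a', a ≠ a'
  · obtain ⟨a', ha'⟩ := ha
    obtain ⟨t, u, ht, hu, h1⟩ := h (Pi.single a 1 + Pi.single a' 6)
    obtain ⟨r, rfl, hr⟩ := ht.pair ha'
    obtain ⟨s, rfl, hs⟩ := hu.pair ha'
    rw [sum_mul_pair] at h1
    norm_cast at h1
    rcases h0 a with h2 | h2 | h2
    · exact h2
    all_goals
      exfalso
      rcases h0 a' with h3 | h3 | h3 <;> rw [h2, h3] at h1 <;> rcases hr with rfl | rfl | rfl <;>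
        rcases hs with rfl | rfl | rfl <;> norm_num at h1
  · push Not at ha
    rw [Finset.sum_eq_single a (fun k _ hk => absurd (ha k).symm hk)
      (fun hn => absurd (Finset.mem_univ a) hn)] at hb
    exact hb

/-- Away from the points -λ_i, P is the product of all t + λ_i times 1 - 2 ∑ λ_i / (t + λ_i). At a
root the second factor vanishes, so only its derivative contributes. -/
lemma hasDerivAt_polyP {lam : Fin d → ℝ} {t : ℝ} (ht : ∀ i, t + lam i ≠ 0)
    (h0 : polyP t lam = 0) :
    HasDerivAt (fun s => polyP s lam)
      ((∏ i, (t + lam i)) * (2 * ∑ i, lam i / (t + lam i) ^ 2)) t := by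
  have hev : (fun s => polyP s lam) =ᶠ[nhds t]
      fun s => (∏ i, (s + lam i)) * (1 - 2 * ∑ i, lam i / (s + lam i)) := by
    have hne : ∀ᶠ s in nhds t, ∀ i, s + lam i ≠ 0 := by
      rw [Filter.eventually_all]
      intro i
      exact (continuous_id.add continuous_const).continuousAt.eventually_ne (ht i)
    filter_upwards [hne] with s hs
    rw [polyP, mul_sub, mul_one, mul_left_comm, Finset.mul_sum (f := fun i => lam i / (s + lam i))]
    congr 2
    refine Finset.sum_congr rfl fun i _ => ?_
    rw [← Finset.mul_prod_erase _ _ (Finset.mem_univ i)]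
    field_simp [hs i]
  refine HasDerivAt.congr_of_eventuallyEq ?_ hev
  have h1 : 1 - 2 * ∑ i, lam i / (t + lam i) = 0 := by
    have h2 := hev.self_of_nhds
    simp only [h0] at h2
    exact (mul_eq_zero.1 h2.symm).resolve_left (Finset.prod_ne_zero_iff.2 fun i _ => ht i)
  have hp : DifferentiableAt ℝ (fun s : ℝ => ∏ i, (s + lam i)) t := by fun_prop
  have hq (i : Fin d) : HasDerivAt (fun s : ℝ => lam i / (s + lam i))
      (-(lam i / (t + lam i) ^ 2)) t := by
    refine ((hasDerivAt_const t (lam i)).div ((hasDerivAt_id t).add_const (lam i))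
      (ht i)).congr_deriv ?_
    simp [neg_div]
  have hs := (((HasDerivAt.fun_sum (u := Finset.univ) fun i _ => hq i).const_mul 2).const_sub 1)
  refine (hp.hasDerivAt.mul hs).congr_deriv ?_
  rw [h1, Finset.sum_neg_distrib]
  ring

/-- The roots of `P(·, λ)` are simple for distinct positive parameters. -/
lemma root_injective {lam : Fin d → ℝ} (hpos : ∀ i, 0 < lam i)
    (hinj : Function.Injective lam) {x : Fin d → ℝ}
    (hx : ∀ t : ℝ, polyP t lam = ∏ i, (t - x i)) : Function.Injective x := by
  intro i k hik
  by_contra hne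
  have h0 : polyP (x i) lam = 0 := by
    rw [hx]
    exact Finset.prod_eq_zero (Finset.mem_univ i) (sub_self _)
  -- At t = -λ_a only the `a`-th term of the sum survives, and it is nonzero for distinct positive
  -- parameters.
  have ht (a : Fin d) : x i + lam a ≠ 0 := by
    intro ha
    have h1 : polyP (x i) lam = -2 * (lam a * ∏ k ∈ Finset.univ.erase a, (x i + lam k)) := by
      rw [polyP, Finset.prod_eq_zero (Finset.mem_univ a) ha, Finset.sum_eq_single a]
      · ring
      · intro c _ hc
        rw [Finset.prod_eq_zero (i := a) (by simp [hc.symm]) ha, mul_zero]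
      · simp
    rw [h0] at h1
    have h2 : ∏ k ∈ Finset.univ.erase a, (x i + lam k) ≠ 0 := by
      refine Finset.prod_ne_zero_iff.2 fun c hc h3 => ?_
      have : lam c = lam a := by linarith
      exact (Finset.mem_erase.1 hc).1 (hinj this)
    have h3 := mul_ne_zero (hpos a).ne' h2
    apply h3
    linarith
  have hd := hasDerivAt_polyP ht h0
  -- A double root makes the derivative vanish, whereas the formula in `hd` has a strictly positive
  -- sum.
  have hd2 : HasDerivAt (fun s => polyP s lam) 0 (x i) := by
    have he : (fun s => polyP s lam) = fun s => (s - x i) ^ 2 *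
        ∏ c ∈ (Finset.univ.erase i).erase k, (s - x c) := by
      funext s
      rw [hx, ← Finset.mul_prod_erase _ _ (Finset.mem_univ i),
        ← Finset.mul_prod_erase (Finset.univ.erase i) _ (a := k) (by simp [Ne.symm hne]), hik]
      ring
    rw [he]
    have hp : DifferentiableAt ℝ
        (fun s : ℝ => ∏ c ∈ (Finset.univ.erase i).erase k, (s - x c)) (x i) := by fun_prop
    refine ((((hasDerivAt_id (x i)).sub_const (x i)).pow 2).mul hp.hasDerivAt).congr_deriv ?_
    simp
  have h1 := hd.unique hd2
  refine absurd h1 (mul_ne_zero (Finset.prod_ne_zero_iff.2 fun a _ => ht a) ?_)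
  refine mul_ne_zero two_ne_zero (ne_of_gt ?_)
  refine Finset.sum_pos (fun a _ => ?_) ⟨i, Finset.mem_univ i⟩
  have := ht a
  have := hpos a
  positivity

/-- Otherwise the product of all coordinate differences, a nonzero polynomial, would vanish on `U`.
-/
lemma exists_injective_mem {U : Set (Fin d → ℝ)} (hU : IsOpen U) (hne : U.Nonempty) :
    ∃ lam ∈ U, Function.Injective lam := by
  by_contra! h
  let p : MvPolynomial (Fin d) ℂ := ∏ q : Fin d × Fin d,
    if q.1 = q.2 then 1 else MvPolynomial.X q.1 - MvPolynomial.X q.2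
  have hp : p = 0 := mvPolynomial_eq_zero_of_isOpen hU hne p fun lam hl => by
    have h1 := h lam hl
    simp only [Function.Injective, not_forall] at h1
    obtain ⟨i, k, hik, hne⟩ := h1
    simp only [p, map_prod]
    refine Finset.prod_eq_zero (Finset.mem_univ (i, k)) ?_
    simp [hne, hik]
  refine absurd hp (Finset.prod_ne_zero_iff.2 fun q _ => ?_)
  split_ifs with hq
  · exact one_ne_zero
  · exact sub_ne_zero.2 fun h2 => hq (MvPolynomial.X_injective h2)

end Roots

/-! ### The three types of factors and their frequencies -/

section Frequencies

variable {d : ℕ} {m : Fin d → ℤ}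

lemma normalFreq_row (hm : StrictMono m) (μ : Fin d → (Fin d → ℝ) → ℝ)
    (μp μm : Fin d → Fin d → (Fin d → ℝ) → ℂ) (ε : ℝ) (lam : Fin d → ℝ) {j : ℤ × ℤ} {i : Fin d}
    (hj : j = (m i, j.2)) (hn : j.2 ≠ 0) :
    normalFreq m μ μp μm ε lam j = ε * μ i lam + (j.2 : ℂ) ^ 2 := by
  have h : j.2 ≠ 0 ∧ ∃ i, j = (m i, j.2) := ⟨hn, i, hj⟩
  have hi : h.2.choose = i := by
    exact hm.injective ((congrArg Prod.fst h.2.choose_spec).symm.trans (congrArg Prod.fst hj))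
  rw [normalFreq, dif_pos h, hi]

lemma not_row_of_notMem {j : ℤ × ℤ} (hj : j ∉ rows m) : ¬(j.2 ≠ 0 ∧ ∃ i, j = (m i, j.2)) :=
  fun h => hj ⟨j.2, h.1, h.2⟩

lemma normalFreq_circle (hgen : IsGeneric m) (μ : Fin d → (Fin d → ℝ) → ℝ)
    (μp μm : Fin d → Fin d → (Fin d → ℝ) → ℂ) (ε : ℝ) (lam : Fin d → ℝ) {j : ℤ × ℤ} {i k : Fin d}
    (hik : i < k) (hj : j ∈ circle m i k) :
    normalFreq m μ μp μm ε lam j = if 0 < j.2 then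
      (j.1 : ℂ) ^ 2 + (j.2 : ℂ) ^ 2 - (m i : ℂ) ^ 2 + ε * μp i k lam
    else (j.1 : ℂ) ^ 2 + (j.2 : ℂ) ^ 2 - (m k : ℂ) ^ 2 - ε * μm i k lam := by
  have h : ∃ q : Fin d × Fin d, q.1 < q.2 ∧ j ∈ circle m q.1 q.2 := ⟨(i, k), hik, hj⟩
  have hr : j ∉ rows m := fun h1 => hgen.notMem_circles h1 (mem_circles hik hj)
  have hq : h.choose = (i, k) :=
    hgen.circle_unique h.choose_spec.1 hik h.choose_spec.2 hj
  rw [normalFreq, dif_neg (not_row_of_notMem hr), dif_pos h, hq]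

lemma normalFreq_free (μ : Fin d → (Fin d → ℝ) → ℝ)
    (μp μm : Fin d → Fin d → (Fin d → ℝ) → ℂ) (ε : ℝ) (lam : Fin d → ℝ) {j : ℤ × ℤ}
    (h1 : j ∉ rows m) (h2 : j ∉ circles m) :
    normalFreq m μ μp μm ε lam j = (j.1 : ℂ) ^ 2 + (j.2 : ℂ) ^ 2 := by
  rw [normalFreq, dif_neg (not_row_of_notMem h1), dif_neg]
  rintro ⟨q, hq, hj⟩
  exact h2 (mem_circles hq hj)

lemma IsRootLabelling.rootP {O : Set (Fin d → ℝ)} {μ : Fin d → (Fin d → ℝ) → ℝ}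
    {μp μm : Fin d → Fin d → (Fin d → ℝ) → ℂ} (h : IsRootLabelling O μ μp μm)
    {lam : Fin d → ℝ} (hl : lam ∈ O) (i : Fin d) : RootP lam (μ i lam) := by
  have h1 := h.roots lam hl (μ i lam)
  rw [Finset.prod_eq_zero (Finset.mem_univ i) (sub_self _), polyP] at h1
  rw [RootP]
  exact_mod_cast h1

lemma IsRootLabelling.rootQ {O : Set (Fin d → ℝ)} {μ : Fin d → (Fin d → ℝ) → ℝ}
    {μp μm : Fin d → Fin d → (Fin d → ℝ) → ℂ} (h : IsRootLabelling O μ μp μm)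
    {lam : Fin d → ℝ} (hl : lam ∈ O) {i k : Fin d} (hik : i < k) :
    RootQ i k lam (μp i k lam) := by
  rw [RootQ, h.roots_pair i k hik lam hl, sub_self, zero_mul]

lemma IsRootLabelling.add_eq {O : Set (Fin d → ℝ)} {μ : Fin d → (Fin d → ℝ) → ℝ}
    {μp μm : Fin d → Fin d → (Fin d → ℝ) → ℂ} (h : IsRootLabelling O μ μp μm)
    {lam : Fin d → ℝ} (hl : lam ∈ O) {i k : Fin d} (hik : i < k) :
    μp i k lam + μm i k lam = lam i - lam k := by
  have h0 := h.roots_pair i k hik lam hl 0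
  have h1 := h.roots_pair i k hik lam hl 1
  simp only [polyQ] at h0 h1
  linear_combination h1 - h0

/-- The site carries a contribution constant in `λ`. -/
structure FlatTerm (m : Fin d → ℤ) (O : Set (Fin d → ℝ)) (j : ℤ × ℤ) (e wM wX : ℝ)
    (D : (Fin d → ℝ) → ℂ) : Prop where
  mass : wM * e = e
  momentum : wX * e = j.1 * e
  notMem : e ≠ 0 → j ∉ rows m
  freq : ∀ lam ∈ O, D lam = ((e * (j.1 ^ 2 + j.2 ^ 2) : ℝ) : ℂ)

/-- The site lies on the row of `i`. -/
structure RowTerm (m : Fin d → ℤ) (O : Set (Fin d → ℝ)) (μ : Fin d → (Fin d → ℝ) → ℝ) (ε : ℝ)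
    (i : Fin d) (j : ℤ × ℤ) (e wM wX : ℝ) (D : (Fin d → ℝ) → ℂ) : Prop where
  sign : e = 1 ∨ e = -1
  mem : j = (m i, j.2)
  ne_zero : j.2 ≠ 0
  mass : wM = 0
  momentum : wX = 0
  freq : ∀ lam ∈ O, D lam = ((e * j.2 ^ 2 : ℝ) : ℂ) + ε * (e * μ i lam)

/-- The site lies on the circle of `(i, k)`, on its upper half if `δ = 0` and on its lower half
if `δ = 1`. -/
structure CircleTerm (m : Fin d → ℤ) (O : Set (Fin d → ℝ))
    (μp : Fin d → Fin d → (Fin d → ℝ) → ℂ) (ε : ℝ) (i k : Fin d) (δ κ : ℝ) (j : ℤ × ℤ)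
    (e wM wX : ℝ) (D : (Fin d → ℝ) → ℂ) : Prop where
  sign : e = 1 ∨ e = -1
  lt : i < k
  mass : wM = 0
  momentum : wX = j.1 - m i + δ * (m i - m k)
  freq : ∀ lam ∈ O, D lam = (κ : ℂ) + ε * (e * (μp i k lam + δ * (lam k - lam i)))

/-- Every factor of a monomial is of one of the three types. -/
lemma term_cases (hm : StrictMono m) (hgen : IsGeneric m) {O : Set (Fin d → ℝ)}
    {μ : Fin d → (Fin d → ℝ) → ℝ} {μp μm : Fin d → Fin d → (Fin d → ℝ) → ℂ}
    (hμ : IsRootLabelling O μ μp μm) (ε : ℝ) (j : NormalSite m) (s : SignType) :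
    FlatTerm m O j.1 s (massWeight m j.1) (momentumXWeight m j.1)
      (fun lam => s * normalFreq m μ μp μm ε lam j.1) ∨
    (∃ i, RowTerm m O μ ε i j.1 s (massWeight m j.1) (momentumXWeight m j.1)
      (fun lam => s * normalFreq m μ μp μm ε lam j.1)) ∨
    ∃ i k δ κ, CircleTerm m O μp ε i k δ κ j.1 s (massWeight m j.1) (momentumXWeight m j.1)
      (fun lam => s * normalFreq m μ μp μm ε lam j.1) := by
  have hcast : ((s : ℝ) : ℂ) = (s : ℂ) := by cases s <;> simp
  -- A factor with exponent zero counts as flat wherever its site lies.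
  by_cases hs : (s : ℝ) = 0
  · left
    have hsc : (s : ℂ) = 0 := by rw [← hcast, hs, Complex.ofReal_zero]
    exact ⟨by rw [hs, mul_zero], by rw [hs, mul_zero, mul_zero], fun h => absurd hs h,
      fun lam _ => by simp [hs, hsc]⟩
  have hsign : (s : ℝ) = 1 ∨ (s : ℝ) = -1 := by
    cases s <;> simp at hs ⊢
  by_cases hr : j.1 ∈ rows m
  · right; left
    obtain ⟨n, hn, i, hi⟩ := hr
    have hn' : j.1.2 = n := by rw [hi]
    subst hn'
    refine ⟨i, hsign, hi, hn, massWeight_rows ⟨_, hn, i, hi⟩,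
      momentumXWeight_rows hgen ⟨_, hn, i, hi⟩, fun lam _ => ?_⟩
    simp only [normalFreq_row hm μ μp μm ε lam hi hn]
    push_cast
    rw [hcast]
    ring
  by_cases hc : j.1 ∈ circles m
  · right; right
    obtain ⟨i, k, hik, hj⟩ := hc
    rcases hj with hj | hj
    · refine ⟨i, k, 0, s * (j.1.1 ^ 2 + j.1.2 ^ 2 - m i ^ 2), hsign, hik,
        massWeight_circles (mem_circles hik (Or.inl hj)), ?_, fun lam _ => ?_⟩
      · rw [momentumXWeight_circlePlus hgen hik hj]
        ring
      · simp only [normalFreq_circle hgen μ μp μm ε lam hik (Or.inl hj), if_pos hj.2]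
        push_cast
        rw [hcast]
        ring
    · refine ⟨i, k, 1, s * (j.1.1 ^ 2 + j.1.2 ^ 2 - m k ^ 2), hsign, hik,
        massWeight_circles (mem_circles hik (Or.inr hj)), ?_, fun lam hl => ?_⟩
      · rw [momentumXWeight_circleMinus hgen hik hj]
        ring
      · simp only [normalFreq_circle hgen μ μp μm ε lam hik (Or.inr hj), if_neg hj.2.not_gt]
        push_cast
        rw [hcast]
        -- The sum of the two roots is λ_i - λ_k, so `-μm` is `μp` plus a linear form; both half
        -- circles are expressed through the same root.
        linear_combination (-(s : ℂ) * ε) * hμ.add_eq hl hik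
  · left
    have hw := massWeight_free j.2 hr hc
    refine ⟨by rw [hw, one_mul], by rw [momentumXWeight_free j.2 hr hc], fun _ => hr,
      fun lam _ => ?_⟩
    simp only [normalFreq_free μ μp μm ε lam hr hc]
    push_cast
    rw [hcast]

/-- A resonance identity on `O` gives, after removal of its constant part, a linear relation
between roots at all parameters. -/
lemma resonance_roots {O : Set (Fin d → ℝ)} (hO : (interior O).Nonempty) {ε : ℝ} (hε : 0 < ε)
    {ℓ : Fin d → ℤ} {D : (Fin d → ℝ) → ℂ}
    (hD : ∀ lam ∈ O, ∑ i, (tangentialFreq m ε lam i : ℂ) * (ℓ i : ℂ) + D lam = 0)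
    {R S : (Fin d → ℝ) → ℂ → Prop} (hR : IsRootRelation R) (hS : IsRootRelation S)
    (hR0 : ∀ t, R 0 t → t = 0) (hS0 : ∀ t, S 0 t → t = 0)
    {ρ τ : (Fin d → ℝ) → ℂ} (hρ : ∀ lam ∈ O, R lam (ρ lam)) (hτ : ∀ lam ∈ O, S lam (τ lam))
    {r s κ : ℝ} (hs : s ≠ 0) {β : Fin d → ℝ}
    (h : ∀ lam ∈ O, D lam =
      κ + ε * (r * ρ lam + s * τ lam + ((∑ i, β i * lam i : ℝ) : ℂ))) :
    (∀ lam ∈ O, r * ρ lam + s * τ lam = ((∑ i, (ℓ i - β i) * lam i : ℝ) : ℂ)) ∧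
    ∀ lam, ∃ t u, R lam t ∧ S lam u ∧
      r * t + s * u = ((∑ i, (ℓ i - β i) * lam i : ℝ) : ℂ) := by
  set c : ℝ := -(κ + ∑ i, (m i : ℝ) ^ 2 * ℓ i) / ε with hc
  have hε' : (ε : ℂ) ≠ 0 := by exact_mod_cast hε.ne'
  have h1 (lam : Fin d → ℝ) (hl : lam ∈ O) :
      r * ρ lam + s * τ lam = ∑ i, ((ℓ i - β i : ℝ) : ℂ) * lam i + c := by
    have h2 := hD lam hl
    rw [h lam hl] at h2
    have h3 : ∑ i, (tangentialFreq m ε lam i : ℂ) * (ℓ i : ℂ) =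
        ((∑ i, (m i : ℝ) ^ 2 * ℓ i : ℝ) : ℂ) - ε * ∑ i, (ℓ i : ℂ) * lam i := by
      rw [Finset.mul_sum]
      push_cast
      rw [← Finset.sum_sub_distrib]
      refine Finset.sum_congr rfl fun i _ => ?_
      rw [tangentialFreq]
      push_cast
      ring
    have h4 : ∑ i, ((ℓ i - β i : ℝ) : ℂ) * lam i =
        ∑ i, (ℓ i : ℂ) * lam i - ((∑ i, β i * lam i : ℝ) : ℂ) := by
      push_cast
      rw [← Finset.sum_sub_distrib]
      exact Finset.sum_congr rfl fun i _ => by ring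
    have h5 : (ε : ℂ) * c = -(κ + ((∑ i, (m i : ℝ) ^ 2 * ℓ i : ℝ) : ℂ)) := by
      rw [hc]
      push_cast
      field_simp
    rw [h4]
    refine mul_left_cancel₀ hε' ?_
    rw [h3] at h2
    linear_combination h2 - h5
  have h2 := IsRootRelation.exists_roots hR hS isOpen_interior hO r
    (s := s) (by exact_mod_cast hs) (fun i => ((ℓ i - β i : ℝ) : ℂ)) c fun lam hl =>
      ⟨ρ lam, τ lam, hρ lam (interior_subset hl), hτ lam (interior_subset hl),
        h1 lam (interior_subset hl)⟩
  -- The extended relation is available at λ = 0, where both roots vanish.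
  have hc0 : (c : ℂ) = 0 := by
    obtain ⟨t, u, ht, hu, h3⟩ := h2 0
    simpa [hR0 t ht, hS0 u hu] using h3.symm
  simp only [hc0, add_zero] at h1 h2
  push_cast at h1 h2 ⊢
  exact ⟨h1, h2⟩

lemma sum_mul_single_sub (i k : Fin d) (a : ℝ) (lam : Fin d → ℝ) :
    ∑ x, (a * ((Pi.single k 1 : Fin d → ℝ) x - (Pi.single i 1 : Fin d → ℝ) x)) * lam x =
      a * (lam k - lam i) := by
  simp [Pi.single_apply, mul_assoc, sub_mul, Finset.sum_sub_distrib, ← Finset.mul_sum]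

end Frequencies

/-! ### Exclusion of resonances, by the types of the two factors -/

section Resonances

variable {d : ℕ} {m : Fin d → ℤ}

/-- A pair of factors satisfying the selection rules whose frequency combination vanishes
identically on `O`. -/
structure Resonance (m : Fin d → ℤ) (O : Set (Fin d → ℝ)) (ε : ℝ) (ℓ : Fin d → ℤ) (j j' : ℤ × ℤ)
    (e e' wM wM' wX wX' : ℝ) (D D' : (Fin d → ℝ) → ℂ) : Prop where
  mass : ∑ i, (ℓ i : ℝ) + (wM * e + wM' * e') = 0
  momentumX : ∑ i, (m i : ℝ) * ℓ i + (wX * e + wX' * e') = 0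
  momentumY : (j.2 : ℝ) * e + j'.2 * e' = 0
  freq : ∀ lam ∈ O, ∑ i, (tangentialFreq m ε lam i : ℂ) * (ℓ i : ℂ) + (D lam + D' lam) = 0

variable {O : Set (Fin d → ℝ)} {ε : ℝ} {ℓ : Fin d → ℤ} {j j' : ℤ × ℤ}
  {e e' wM wM' wX wX' : ℝ} {D D' : (Fin d → ℝ) → ℂ}

lemma Resonance.symm (h : Resonance m O ε ℓ j j' e e' wM wM' wX wX' D D') :
    Resonance m O ε ℓ j' j e' e wM' wM wX' wX D' D where
  mass := by linarith [h.mass]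
  momentumX := by linarith [h.momentumX]
  momentumY := by linarith [h.momentumY]
  freq lam hl := by linear_combination h.freq lam hl

lemma sites_eq (he : e = 1 ∨ e = -1) (he' : e' = -e) (h1 : (j.1 : ℝ) * e + j'.1 * e' = 0)
    (h2 : (j.2 : ℝ) * e + j'.2 * e' = 0) : j = j' := by
  have h1' : (j.1 : ℝ) = j'.1 := by
    rcases he with rfl | rfl <;> rw [he'] at h1 <;> linarith
  have h2' : (j.2 : ℝ) = j'.2 := by
    rcases he with rfl | rfl <;> rw [he'] at h2 <;> linarith
  exact Prod.ext (by exact_mod_cast h1') (by exact_mod_cast h2')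

lemma sign_ne_zero (he : e = 1 ∨ e = -1) : e ≠ 0 := by
  rcases he with rfl | rfl <;> norm_num

/-- A linear form vanishing identically has zero coefficients. -/
lemma coeff_eq_zero {b : Fin d → ℝ} (h : ∀ lam : Fin d → ℝ, ∃ t u, RootZero lam t ∧
    RootZero lam u ∧ ((1 : ℝ) : ℂ) * t + ((1 : ℝ) : ℂ) * u = ((∑ i, b i * lam i : ℝ) : ℂ))
    (a : Fin d) : b a = 0 := by
  obtain ⟨t, u, rfl, rfl, h1⟩ := h (Pi.single a 1)
  rw [sum_mul_single] at h1
  simpa using h1.symm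

lemma tangential_eq_zero (hO : (interior O).Nonempty) (hε : 0 < ε)
    (h : ∀ lam ∈ O, ∑ i, (tangentialFreq m ε lam i : ℂ) * (ℓ i : ℂ) = 0) : ℓ = 0 := by
  have h1 := (resonance_roots (D := fun _ => 0) hO hε (fun lam hl => by rw [h lam hl, add_zero])
    isRootRelation_rootZero isRootRelation_rootZero
    (fun t ht => ht) (fun t ht => ht) (ρ := fun _ => 0) (τ := fun _ => 0) (fun _ _ => rfl)
    (fun _ _ => rfl) (r := 1) (s := 1) (κ := 0) one_ne_zero (β := 0) fun lam hl => by simp).2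
  funext a
  simpa using coeff_eq_zero h1 a

lemma Resonance.flat_flat (hO : (interior O).Nonempty) (hε : 0 < ε)
    (h : Resonance m O ε ℓ j j' e e' wM wM' wX wX' D D') (hf : FlatTerm m O j e wM wX D)
    (hf' : FlatTerm m O j' e' wM' wX' D') :
    e' = -e ∧ (j.1 : ℝ) * e + j'.1 * e' = 0 := by
  have h1 := (resonance_roots (D := fun lam => D lam + D' lam) hO hε h.freq
    isRootRelation_rootZero isRootRelation_rootZero
    (fun t ht => ht) (fun t ht => ht) (ρ := fun _ => 0) (τ := fun _ => 0) (fun _ _ => rfl)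
    (fun _ _ => rfl) (r := 1) (s := 1)
    (κ := e * (j.1 ^ 2 + j.2 ^ 2) + e' * (j'.1 ^ 2 + j'.2 ^ 2)) one_ne_zero (β := 0)
    fun lam hl => by
      rw [hf.freq lam hl, hf'.freq lam hl]
      simp).2
  have hℓ : ℓ = 0 := by
    funext a
    have := coeff_eq_zero h1 a
    simpa using this
  have hM := h.mass
  have hX := h.momentumX
  rw [hf.mass, hf'.mass, hℓ] at hM
  rw [hf.momentum, hf'.momentum, hℓ] at hX
  simp at hM hX
  exact ⟨by linarith, hX⟩

/-- A root of P is a linear form only for d = 1. There the selection rules give opposite signs and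
equal sites, so the flat site would lie on a row. -/
lemma Resonance.not_row_flat (hO : (interior O).Nonempty) (hε : 0 < ε)
    {μ : Fin d → (Fin d → ℝ) → ℝ} {μp μm : Fin d → Fin d → (Fin d → ℝ) → ℂ}
    (hμ : IsRootLabelling O μ μp μm)
    (h : Resonance m O ε ℓ j j' e e' wM wM' wX wX' D D') {i : Fin d}
    (hr : RowTerm m O μ ε i j e wM wX D) (hf' : FlatTerm m O j' e' wM' wX' D') : False := by
  have h1 := (resonance_roots (D := fun lam => D lam + D' lam) hO hε h.freq
    isRootRelation_rootP isRootRelation_rootZero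
    (fun t ht => ht.zero) (fun t ht => ht) (ρ := fun lam => μ i lam) (τ := fun _ => 0)
    (fun lam hl => hμ.rootP hl i)
    (fun _ _ => rfl) (r := e) (s := 1)
    (κ := e * j.2 ^ 2 + e' * (j'.1 ^ 2 + j'.2 ^ 2)) one_ne_zero (β := 0)
    fun lam hl => by
      rw [hr.freq lam hl, hf'.freq lam hl]
      simp
      ring).2
  obtain ⟨hd, hb⟩ := eq_of_linear_root hr.sign (b := fun i => ℓ i - (0 : Fin d → ℝ) i)
    fun lam => by
      obtain ⟨t, u, ht, rfl, h2⟩ := h1 lam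
      exact ⟨t, ht, by simpa using h2⟩
  subst hd
  obtain rfl : i = 0 := Subsingleton.elim _ _
  have hM := h.mass
  have hX := h.momentumX
  rw [hr.mass, hf'.mass] at hM
  rw [hr.momentum, hf'.momentum] at hX
  simp at hM hX hb
  have he' : e' = -e := by linarith
  have he0 := sign_ne_zero hr.sign
  have hmj : j = j' := by
    refine sites_eq hr.sign he' ?_ h.momentumY
    have h3 : (j.1 : ℝ) = m 0 := by
      rw [hr.mem]
    rw [h3, ← hX, ← hb]
  refine hf'.notMem (by rw [he']; exact neg_ne_zero.2 he0) ?_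
  rw [← hmj]
  exact ⟨j.2, hr.ne_zero, 0, hr.mem⟩

lemma Resonance.row_row (hO : (interior O).Nonempty) (hpos : ∀ lam ∈ O, ∀ i, 0 < lam i)
    (hε : 0 < ε) {μ : Fin d → (Fin d → ℝ) → ℝ} {μp μm : Fin d → Fin d → (Fin d → ℝ) → ℂ}
    (hμ : IsRootLabelling O μ μp μm)
    (h : Resonance m O ε ℓ j j' e e' wM wM' wX wX' D D') {i i' : Fin d}
    (hr : RowTerm m O μ ε i j e wM wX D) (hr' : RowTerm m O μ ε i' j' e' wM' wX' D') :
    e' = -e ∧ (j.1 : ℝ) * e + j'.1 * e' = 0 := by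
  obtain ⟨h0, h1⟩ := resonance_roots (D := fun lam => D lam + D' lam) hO hε h.freq
    isRootRelation_rootP isRootRelation_rootP
    (fun t ht => ht.zero) (fun t ht => ht.zero) (ρ := fun lam => μ i lam)
    (τ := fun lam => μ i' lam) (fun lam hl => hμ.rootP hl i)
    (fun lam hl => hμ.rootP hl i') (r := e) (s := e')
    (κ := e * j.2 ^ 2 + e' * j'.2 ^ 2) (sign_ne_zero hr'.sign) (β := 0)
    fun lam hl => by
      rw [hr.freq lam hl, hr'.freq lam hl]
      simp
      ring
  have hb : ∑ a, ((ℓ a : ℝ) - (0 : Fin d → ℝ) a) = 0 := by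
    have hM := h.mass
    rw [hr.mass, hr'.mass] at hM
    simpa using hM
  have he : e' = e ∨ e' = -e := by
    rcases hr.sign with rfl | rfl <;> rcases hr'.sign with rfl | rfl <;> norm_num
  rcases he with rfl | rfl
  · exact (not_linear_add hr.sign hb h1).elim
  · have hb0 (a : Fin d) : e * ((ℓ a : ℝ) - (0 : Fin d → ℝ) a) = 0 := by
      refine eq_zero_of_linear_sub (b := fun a => e * ((ℓ a : ℝ) - (0 : Fin d → ℝ) a))
        (by rw [← Finset.mul_sum, hb, mul_zero]) (fun lam => ?_) a
      obtain ⟨t, u, ht, hu, h2⟩ := h1 lam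
      refine ⟨t, u, ht, hu, ?_⟩
      simp only [mul_assoc, ← Finset.mul_sum]
      rw [Complex.ofReal_mul, ← h2]
      rcases hr.sign with rfl | rfl <;> push_cast <;> ring
    have hℓ : ℓ = 0 := by
      funext a
      have := (mul_eq_zero.1 (hb0 a)).resolve_left (sign_ne_zero hr.sign)
      simpa using this
    refine ⟨rfl, ?_⟩
    -- With `ℓ = 0` the labelled roots `μ i` and `μ i'` agree on `O`; at distinct parameters the
    -- roots are simple, so `i = i'`.
    obtain ⟨lam, hl, hinj⟩ := exists_injective_mem isOpen_interior hO
    have hl' := interior_subset hl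
    have h2 := h0 lam hl'
    simp only [hℓ, Pi.zero_apply, Int.cast_zero, sub_zero, zero_mul, Finset.sum_const_zero] at h2
    norm_cast at h2
    have h3 : μ i lam = μ i' lam := by
      rcases hr.sign with rfl | rfl <;> linarith
    have h4 : i = i' := root_injective (hpos lam hl') hinj (x := fun a => μ a lam)
      (hμ.roots lam hl') h3
    rw [hr.mem, hr'.mem, h4]
    ring

/-- The linear form carried by a lower half circle. -/
def circleShift (i k : Fin d) (a : ℝ) (x : Fin d) : ℝ :=
  a * ((Pi.single k 1 : Fin d → ℝ) x - (Pi.single i 1 : Fin d → ℝ) x)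

lemma sum_circleShift (i k : Fin d) (a : ℝ) (lam : Fin d → ℝ) :
    ∑ x, circleShift i k a x * lam x = a * (lam k - lam i) := sum_mul_single_sub i k a lam

/-- The relation would express a root of t² + 3 through real numbers. -/
lemma not_affine_rootQ {R : (Fin d → ℝ) → ℂ → Prop} (i k : Fin d)
    {lam : Fin d → ℝ} (hi : lam i = 1) (hk : lam k = 1)
    (hR : ∀ u, R lam u → ∃ r : ℝ, u = r) {a a' c : ℝ} (ha : a ≠ 0)
    (h : ∃ t u, RootQ i k lam t ∧ R lam u ∧ (a : ℂ) * t + (a' : ℂ) * u = (c : ℂ)) : False := by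
  obtain ⟨t, u, ht, hu, h1⟩ := h
  obtain ⟨r, rfl⟩ := hR u hu
  have ha' : (a : ℂ) ≠ 0 := by exact_mod_cast ha
  have h2 : t = ((c - a' * r) / a : ℝ) := by
    push_cast
    rw [eq_div_iff ha']
    linear_combination h1
  subst h2
  exact ht.not_real hi hk

lemma Resonance.not_circle_flat (hO : (interior O).Nonempty) (hε : 0 < ε)
    {μ : Fin d → (Fin d → ℝ) → ℝ} {μp μm : Fin d → Fin d → (Fin d → ℝ) → ℂ}
    (hμ : IsRootLabelling O μ μp μm)
    (h : Resonance m O ε ℓ j j' e e' wM wM' wX wX' D D') {i k : Fin d} {δ κ : ℝ}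
    (hc : CircleTerm m O μp ε i k δ κ j e wM wX D) (hf' : FlatTerm m O j' e' wM' wX' D') :
    False := by
  have h1 := (resonance_roots (D := fun lam => D lam + D' lam) hO hε h.freq
    (isRootRelation_rootQ i k) isRootRelation_rootZero
    (fun t ht => ht.zero) (fun t ht => ht) (ρ := fun lam => μp i k lam) (τ := fun _ => 0)
    (fun lam hl => hμ.rootQ hl hc.lt)
    (fun _ _ => rfl) (r := e) (s := 1)
    (κ := κ + e' * (j'.1 ^ 2 + j'.2 ^ 2)) one_ne_zero (β := circleShift i k (e * δ))
    fun lam hl => by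
      rw [hc.freq lam hl, hf'.freq lam hl, sum_circleShift]
      push_cast
      ring).2
  exact not_affine_rootQ i k (lam := fun _ => 1) rfl rfl
    (fun u hu => ⟨0, by rw [hu, Complex.ofReal_zero]⟩) (sign_ne_zero hc.sign) (h1 _)

lemma Resonance.not_circle_row (hO : (interior O).Nonempty) (hε : 0 < ε)
    {μ : Fin d → (Fin d → ℝ) → ℝ} {μp μm : Fin d → Fin d → (Fin d → ℝ) → ℂ}
    (hμ : IsRootLabelling O μ μp μm)
    (h : Resonance m O ε ℓ j j' e e' wM wM' wX wX' D D') {i k i' : Fin d} {δ κ : ℝ}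
    (hc : CircleTerm m O μp ε i k δ κ j e wM wX D) (hr' : RowTerm m O μ ε i' j' e' wM' wX' D') :
    False := by
  have h1 := (resonance_roots (D := fun lam => D lam + D' lam) hO hε h.freq
    (isRootRelation_rootQ i k) isRootRelation_rootP
    (fun t ht => ht.zero) (fun t ht => ht.zero) (ρ := fun lam => μp i k lam)
    (τ := fun lam => μ i' lam) (fun lam hl => hμ.rootQ hl hc.lt)
    (fun lam hl => hμ.rootP hl i') (r := e) (s := e')
    (κ := κ + e' * j'.2 ^ 2) (sign_ne_zero hr'.sign) (β := circleShift i k (e * δ))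
    fun lam hl => by
      rw [hc.freq lam hl, hr'.freq lam hl, sum_circleShift]
      push_cast
      ring).2
  exact not_affine_rootQ i k (lam := fun _ => 1) rfl rfl
    (fun u hu => let ⟨r, hr, _⟩ := hu.ones; ⟨r, hr⟩) (sign_ne_zero hc.sign) (h1 _)

/-- Equal signs double a nonreal root, which is impossible. Opposite signs cancel the roots and
determine `ℓ`; its contribution to the momentum exactly undoes the shifts `m i - m k` in the weights
of the lower half circle. -/
lemma Resonance.same_circle (hO : (interior O).Nonempty) (hε : 0 < ε)
    {μ : Fin d → (Fin d → ℝ) → ℝ} {μp μm : Fin d → Fin d → (Fin d → ℝ) → ℂ}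
    (hμ : IsRootLabelling O μ μp μm)
    (h : Resonance m O ε ℓ j j' e e' wM wM' wX wX' D D') {i k : Fin d} {δ κ δ' κ' : ℝ}
    (hc : CircleTerm m O μp ε i k δ κ j e wM wX D)
    (hc' : CircleTerm m O μp ε i k δ' κ' j' e' wM' wX' D') :
    e' = -e ∧ (j.1 : ℝ) * e + j'.1 * e' = 0 := by
  have he : e' = e ∨ e' = -e := by
    rcases hc.sign with rfl | rfl <;> rcases hc'.sign with rfl | rfl <;> norm_num
  rcases he with rfl | rfl
  · have h1 := (resonance_roots (D := fun lam => D lam + D' lam) hO hε h.freq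
      (isRootRelation_rootQ i k) isRootRelation_rootZero
      (fun t ht => ht.zero) (fun t ht => ht) (ρ := fun lam => μp i k lam) (τ := fun _ => 0)
      (fun lam hl => hμ.rootQ hl hc.lt)
      (fun _ _ => rfl) (r := 2 * e') (s := 1)
      (κ := κ + κ') one_ne_zero (β := circleShift i k (e' * (δ + δ')))
      fun lam hl => by
        rw [hc.freq lam hl, hc'.freq lam hl, sum_circleShift]
        push_cast
        ring).2
    exact (not_affine_rootQ i k (lam := fun _ => 1) rfl rfl
      (fun u hu => ⟨0, by rw [hu, Complex.ofReal_zero]⟩)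
      (mul_ne_zero two_ne_zero (sign_ne_zero hc.sign)) (h1 _)).elim
  · refine ⟨rfl, ?_⟩
    have h1 := (resonance_roots (D := fun lam => D lam + D' lam) hO hε h.freq
      isRootRelation_rootZero isRootRelation_rootZero
      (fun t ht => ht) (fun t ht => ht) (ρ := fun _ => 0) (τ := fun _ => 0)
      (fun _ _ => rfl) (fun _ _ => rfl) (r := 1) (s := 1)
      (κ := κ + κ') one_ne_zero (β := circleShift i k (e * (δ - δ')))
      fun lam hl => by
        rw [hc.freq lam hl, hc'.freq lam hl, sum_circleShift]
        push_cast
        ring).2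
    have hℓ (a : Fin d) : (ℓ a : ℝ) = circleShift i k (e * (δ - δ')) a :=
      sub_eq_zero.1 (coeff_eq_zero h1 a)
    have hX := h.momentumX
    have hs : ∑ a, (m a : ℝ) * ℓ a = e * (δ - δ') * (m k - m i) := by
      rw [← sum_circleShift i k (e * (δ - δ')) fun a => (m a : ℝ)]
      exact Finset.sum_congr rfl fun a _ => by rw [hℓ, mul_comm]
    rw [hs, hc.momentum, hc'.momentum] at hX
    linear_combination hX

lemma exists_not_mem_pair {i k i' k' : Fin d} (h : i < k) (h' : i' < k') (hne : (i, k) ≠ (i', k')) :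
    ∃ a, a ≠ i ∧ a ≠ k ∧ (a = i' ∨ a = k') := by
  by_contra! hcon
  have h1 := hcon i'
  have h2 := hcon k'
  apply hne
  grind

lemma Resonance.circle_eq (hO : (interior O).Nonempty) (hε : 0 < ε)
    {μ : Fin d → (Fin d → ℝ) → ℝ} {μp μm : Fin d → Fin d → (Fin d → ℝ) → ℂ}
    (hμ : IsRootLabelling O μ μp μm)
    (h : Resonance m O ε ℓ j j' e e' wM wM' wX wX' D D') {i k i' k' : Fin d} {δ κ δ' κ' : ℝ}
    (hc : CircleTerm m O μp ε i k δ κ j e wM wX D)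
    (hc' : CircleTerm m O μp ε i' k' δ' κ' j' e' wM' wX' D') : (i, k) = (i', k') := by
  by_contra hne
  obtain ⟨a, hi, hk, ha⟩ := exists_not_mem_pair hc.lt hc'.lt hne
  have h1 := (resonance_roots (D := fun lam => D lam + D' lam) hO hε h.freq
    (isRootRelation_rootQ i k) (isRootRelation_rootQ i' k')
    (fun t ht => ht.zero) (fun t ht => ht.zero) (ρ := fun lam => μp i k lam)
    (τ := fun lam => μp i' k' lam) (fun lam hl => hμ.rootQ hl hc.lt)
    (fun lam hl => hμ.rootQ hl hc'.lt) (r := e) (s := e')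
    (κ := κ + κ') (sign_ne_zero hc'.sign)
    (β := fun x => circleShift i k (e * δ) x + circleShift i' k' (e' * δ') x)
    fun lam hl => by
      simp only [add_mul, Finset.sum_add_distrib, sum_circleShift]
      rw [hc.freq lam hl, hc'.freq lam hl]
      push_cast
      ring).2
  -- The index `a` belongs to the second pair only: setting its parameter to 0 makes the roots of
  -- the second Q real and keeps those of the first nonreal.
  refine not_affine_rootQ i k (lam := Function.update (fun _ => 1) a 0)
    (Function.update_of_ne hi.symm _ _) (Function.update_of_ne hk.symm _ _)
    (fun u hu => hu.real ?_) (sign_ne_zero hc.sign) (h1 _)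
  rcases ha with rfl | rfl
  · exact Or.inl (Function.update_self _ _ _)
  · exact Or.inr (Function.update_self _ _ _)

end Resonances

end NLSTorus

end

/-! ### Assembly of the cases -/

theorem mainTheorem9 {d : ℕ} (m : Fin d → ℤ) (hm : StrictMono m)
    (hgen : NLSTorus.IsGeneric m) (p : ℝ) (hp : 1 < p)
    (O : Set (Fin d → ℝ)) (hpos : ∀ lam ∈ O, ∀ i, 0 < lam i) (hO : (interior O).Nonempty)
    (μ : Fin d → (Fin d → ℝ) → ℝ) (μp μm : Fin d → Fin d → (Fin d → ℝ) → ℂ)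
    (hμ : NLSTorus.IsRootLabelling O μ μp μm)
    (ε : ℝ) (hε : 0 < ε)
    (j : Fin 2 → NLSTorus.NormalSite m) (ℓ : Fin d → ℤ) (σ : Fin 2 → SignType)
    (hadm : NLSTorus.Admissible p j ℓ σ)
    (htriv : ¬ (j 0 = j 1 ∧ ℓ = 0 ∧ σ 1 = -σ 0))
    (hconst : ¬ (ℓ = 0 ∧ σ = 0)) :
    ∃ lam ∈ O,
      (∑ i, (NLSTorus.tangentialFreq m ε lam i : ℂ) * (ℓ i : ℂ))
        + (σ 0 : ℂ) * NLSTorus.normalFreq m μ μp μm ε lam (j 0)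
        + (σ 1 : ℂ) * NLSTorus.normalFreq m μ μp μm ε lam (j 1) ≠ 0 := by
  by_contra! hvan
  have hres : NLSTorus.Resonance m O ε ℓ (j 0).1 (j 1).1 (σ 0 : ℝ) (σ 1 : ℝ)
      (NLSTorus.massWeight m (j 0).1) (NLSTorus.massWeight m (j 1).1)
      (NLSTorus.momentumXWeight m (j 0).1) (NLSTorus.momentumXWeight m (j 1).1)
      (fun lam => (σ 0 : ℂ) * NLSTorus.normalFreq m μ μp μm ε lam (j 0))
      (fun lam => (σ 1 : ℂ) * NLSTorus.normalFreq m μ μp μm ε lam (j 1)) := by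
    obtain ⟨h1, h2, h3⟩ := hadm.selection
    rw [Fin.sum_univ_two] at h1 h2 h3
    exact ⟨h1, h2, h3, fun lam hl => by rw [← add_assoc]; exact hvan lam hl⟩
  have key : (σ 1 : ℝ) = -(σ 0 : ℝ) ∧
      ((j 0).1.1 : ℝ) * (σ 0 : ℝ) + (j 1).1.1 * (σ 1 : ℝ) = 0 := by
    rcases NLSTorus.term_cases hm hgen hμ ε (j 0) (σ 0) with h0 | ⟨i, h0⟩ | ⟨i, k, δ, κ, h0⟩ <;>
    rcases NLSTorus.term_cases hm hgen hμ ε (j 1) (σ 1) with h1 | ⟨i', h1⟩ | ⟨i', k', δ', κ', h1⟩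
    · exact hres.flat_flat hO hε h0 h1
    · exact (hres.symm.not_row_flat hO hε hμ h1 h0).elim
    · exact (hres.symm.not_circle_flat hO hε hμ h1 h0).elim
    · exact (hres.not_row_flat hO hε hμ h0 h1).elim
    · exact hres.row_row hO hpos hε hμ h0 h1
    · exact (hres.symm.not_circle_row hO hε hμ h1 h0).elim
    · exact (hres.not_circle_flat hO hε hμ h0 h1).elim
    · exact (hres.not_circle_row hO hε hμ h0 h1).elim
    · obtain ⟨rfl, rfl⟩ := Prod.ext_iff.1 (hres.circle_eq hO hε hμ h0 h1)
      exact hres.same_circle hO hε hμ h0 h1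
  obtain ⟨hσ, hX⟩ := key
  have hσ' : σ 1 = -σ 0 := by
    revert hσ
    generalize σ 0 = s
    generalize σ 1 = t
    cases s <;> cases t <;> norm_num
  by_cases h0 : σ 0 = 0
  · have h1 : σ 1 = 0 := by rw [hσ', h0, neg_zero]
    refine hconst ⟨NLSTorus.tangential_eq_zero (m := m) hO hε fun lam hl => ?_, ?_⟩
    · simpa [h0, h1] using hvan lam hl
    · funext r
      fin_cases r
      · exact h0
      · exact h1
  · have hsign : (σ 0 : ℝ) = 1 ∨ (σ 0 : ℝ) = -1 := by
      revert h0
      generalize σ 0 = s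
      cases s <;> simp
    have hj : j 0 = j 1 := Subtype.ext (NLSTorus.sites_eq hsign hσ hX hres.momentumY)
    -- Equal sites with opposite signs cancel the normal frequencies, leaving a purely tangential
    -- identity that forces `ℓ = 0`.
    refine htriv ⟨hj, NLSTorus.tangential_eq_zero (m := m) hO hε fun lam hl => ?_, hσ'⟩
    have hc : (σ 1 : ℂ) = -(σ 0 : ℂ) := by
      rw [hσ']
      generalize σ 0 = s
      cases s <;> simp
    have h2 := hvan lam hl
    rw [hj, hc] at h2
    linear_combination h2
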